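/- Let $\sigma,\nu>0$, $r\in\mathbb R$, $S_0,K>0$, $q\ge 1$ and $0\le t<T$, and put $\tau:=T-t$. Let $(X_t)_{t\ge 0}$ be a symmetric Variance Gamma process on a filtered probability space $(\Omega,(\mathcal F_t),\mathbb Q)$: $X$ is adapted, $X_0=0$, and for $s<u$ the increment $X_u-X_s$ is independent of $\mathcal F_s$ and distributed as $\sigma\sqrt{\gamma}\,Z$, where $\gamma$ has the Gamma law of mean $u-s$ and variance $\nu(u-s)$, and $Z$ is standard normal, independent of $\gamma$. Put $$\omega:=\tfrac1\nu\log\bigl(1-\tfrac{\sigma^2\nu}{2}\bigr),\quad S_t:=S_0e^{(r+\omega)t+X_t},\quad \sigma_\nu:=\sigma\sqrt{\tfrac{\nu}{2}},\quad F:=Ke^{-r\tau},\quad \alpha:=\tfrac{\tau}{\nu}-\tfrac12,\quad \tilde k:=\log\frac{S_t}{K^{1/q}}+r\tau+\omega\tau .$$ Assume that $q\sigma_\nu<1$ (so that $\mathbb E^{\mathbb Q}[S_T^q]<\infty$) and $\alpha\notin\mathbb Z$. Let $C:=\mathbb E^{\mathbb Q}\bigl[e^{-r\tau}S_T^q\,\mathbf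 1_{\{S_T^q>K\}}\mid\mathcal F_t\bigr]$ be the value at time $t$ of the power asset-or-nothing call, and for $k/s<0$ put $$C^-(k,s):=\frac{F}{2\Gamma(\frac{\tau}{\nu})}\sum_{n_1,n_2\ge0}\frac{(-1)^{n_1}}{n_1!}q^{n_2}\left[\frac{\Gamma(\frac{-n_1+n_2+1}{2}+\alpha)}{\Gamma(\frac{-n_1+n_2}{2}+1)}\Bigl(\frac{-k}{s}\Bigr)^{n_1}s^{n_2}+2\,\frac{\Gamma(-2n_1-n_2-1-2\alpha)}{\Gamma(-n_1+\frac12-\alpha)}\Bigl(\frac{-k}{s}\Bigr)^{2n_1+1+2\alpha}(-k)^{n_2}\right],$$ where $1/\Gamma:=0$ at the poles of $\Gamma$ and, if $\tau/\nu$ is an integer, the Gamma quotients are read by continuity in $\alpha$. Then $S_T^q$ and the payoff are integrable, and almost surely: (i) (OTM) if $\tilde k<0$, the double series $C^-(\tilde k,\sigma_\nu)$ converges absolutely and $C=C^-(\tilde k,\sigma_\nu)$; (ii) (ATM) if $\tilde k=0$, then $$C=\frac{F}{2\Gamma(\frac{\tau}{\nu})}\sum_{n=0}^\infty\frac{\Gamma(\frac{n+1}{2}+\alpha)}{\Gamma(\frac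 n2+1)}(q\sigma_\nu)^n,$$ the series being absolutely convergent; (iii) (ITM) if $\tilde k>0$, the double series $C^-(\tilde k,-\sigma_\nu)$ converges absolutely and $$C=e^{-r\tau}\,\mathbb E^{\mathbb Q}[S_T^q\mid\mathcal F_t]-C^-(\tilde k,-\sigma_\nu);$$ moreover $$e^{-r\tau}\,\mathbb E^{\mathbb Q}[S_T^q\mid\mathcal F_t]=S_t^q\,e^{((q-1)r+q\omega)\tau}\,(1-q^2\sigma_\nu^2)^{-\tau/\nu}.$$ -/

import Mathlib

open MeasureTheory ProbabilityTheory Filter Topology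
open scoped NNReal

namespace SymVG

noncomputable section

/-- Law at time `t > 0` of the symmetric Variance Gamma process, i.e. of `σ W(γ_t)`, a driftless
Brownian motion of volatility `σ` evaluated at an independent Gamma time `γ_t` with mean `t` and
variance `ν t` (shape `t / ν`, rate `1 / ν`). Given `γ_t = y`, `W(y)` is distributed as `√y Z`
with `Z` standard normal. -/
def vgLaw (σ ν t : ℝ) : Measure ℝ :=
  ((gammaMeasure (t / ν) (1 / ν)).prod (gaussianReal 0 1)).map
    (fun p : ℝ × ℝ => σ * (Real.sqrt p.1 * p.2))

/-- `X` is a symmetric Variance Gamma process with scale `σ` and kurtosis parameter `ν`, relative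
to the filtration `ℱ`: it is adapted, starts at `0`, and the increments over `(s, t]` are
independent of `ℱ s` with the Variance Gamma law of the time span `t - s`. -/
structure IsVGProcess {Ω : Type*} [mΩ : MeasurableSpace Ω] (Q : Measure Ω)
    (ℱ : Filtration ℝ≥0 mΩ) (σ ν : ℝ) (X : ℝ≥0 → Ω → ℝ) : Prop where
  adapted : ∀ t, Measurable[ℱ t] (X t)
  start_zero : ∀ᵐ w ∂Q, X 0 w = 0
  indep_increments : ∀ s t, s < t →
    Indep (MeasurableSpace.comap (fun w => X t w - X s w) inferInstance) (ℱ s) Q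
  law_increments : ∀ s t : ℝ≥0, s < t →
    Q.map (fun w => X t w - X s w) = vgLaw σ ν ((t : ℝ) - (s : ℝ))

/-- Martingale adjustment `ω` of the symmetric model. -/
def martAdj (σ ν : ℝ) : ℝ := 1 / ν * Real.log (1 - σ ^ 2 * ν / 2)

/-- Re-scaled volatility `σ_ν`. -/
def rescaledVol (σ ν : ℝ) : ℝ := σ * Real.sqrt (ν / 2)

/-- Price process of the asset, `S_t = S_0 exp ((r + ω) t + X_t)`. -/
def stock {Ω : Type*} (S₀ r σ ν : ℝ) (X : ℝ≥0 → Ω → ℝ) (t : ℝ≥0) (w : Ω) : ℝ :=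
  S₀ * Real.exp ((r + martAdj σ ν) * t + X t w)

open Classical in
/-- Payoff `s ^ q 1{s ^ q > K}` of the power asset-or-nothing call. -/
def powerPayoff (q K s : ℝ) : ℝ := if K < s ^ q then s ^ q else 0

/-- Value at time `t` of the power asset-or-nothing call: the risk-neutral conditional expectation
of the discounted payoff. -/
def powerCallValue {Ω : Type*} [mΩ : MeasurableSpace Ω] (Q : Measure Ω)
    (ℱ : Filtration ℝ≥0 mΩ) (S₀ K r q σ ν : ℝ) (X : ℝ≥0 → Ω → ℝ) (t T : ℝ≥0) : Ω → ℝ :=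
  condExp (ℱ t) Q
    (fun w => Real.exp (-r * ((T : ℝ) - t)) * powerPayoff q K (stock S₀ r σ ν X T w))

/-- Moneyness `k̃ = log (S / K ^ (1 / q)) + r τ + ω τ` for the spot price `S`. -/
def powerMoneyness (S K r q σ ν τ : ℝ) : ℝ :=
  Real.log (S / K ^ (1 / q)) + r * τ + martAdj σ ν * τ

/-- Coefficient `Γ((-n₁ + n₂ + 1) / 2 + α) / Γ((-n₁ + n₂) / 2 + 1)`, where `1 / Γ` is `0` at the
poles of `Γ` (`Real.Gamma` vanishes there and `x / 0 = 0`). -/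
def coeffA (α : ℝ) (n : ℕ × ℕ) : ℝ :=
  Real.Gamma ((-(n.1 : ℝ) + n.2 + 1) / 2 + α) / Real.Gamma ((-(n.1 : ℝ) + n.2) / 2 + 1)

/-- The quotient `Γ(-2 n₁ - n₂ - 1 - 2 α) / Γ(-n₁ + 1/2 - α)`. -/
def coeffBQuot (n : ℕ × ℕ) (α : ℝ) : ℝ :=
  Real.Gamma (-2 * (n.1 : ℝ) - n.2 - 1 - 2 * α) / Real.Gamma (-(n.1 : ℝ) + 1 / 2 - α)

/-- The quotient `coeffBQuot`, read by continuity in `α`. It is the plain quotient unless `2 α` is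
an integer (see `coeffB_eq`); when `α + 1/2` is a positive integer both Gamma functions have a pole
and the value is that of the removable singularity. -/
def coeffB (α : ℝ) (n : ℕ × ℕ) : ℝ := limUnder (𝓝[≠] α) (coeffBQuot n)

theorem coeffB_eq (α : ℝ) (n : ℕ × ℕ) (h : ∀ m : ℤ, 2 * α ≠ m) :
    coeffB α n = coeffBQuot n α := by
  have h1 : ∀ m : ℕ, -2 * (n.1 : ℝ) - n.2 - 1 - 2 * α ≠ -m := by
    intro m hm
    apply h ((m : ℤ) - 2 * n.1 - n.2 - 1)
    push_cast
    linarith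
  have h2 : ∀ m : ℕ, -(n.1 : ℝ) + 1 / 2 - α ≠ -m := by
    intro m hm
    apply h (2 * (m : ℤ) - 2 * n.1 + 1)
    push_cast
    linarith
  have c1 : ContinuousAt
      (fun a : ℝ => Real.Gamma (-2 * (n.1 : ℝ) - n.2 - 1 - 2 * a)) α :=
    ContinuousAt.comp (f := fun a : ℝ => -2 * (n.1 : ℝ) - n.2 - 1 - 2 * a)
      (Real.differentiableAt_Gamma h1).continuousAt (by fun_prop)
  have c2 : ContinuousAt (fun a : ℝ => Real.Gamma (-(n.1 : ℝ) + 1 / 2 - a)) α :=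
    ContinuousAt.comp (f := fun a : ℝ => -(n.1 : ℝ) + 1 / 2 - a)
      (Real.differentiableAt_Gamma h2).continuousAt (by fun_prop)
  have c : ContinuousAt (coeffBQuot n) α := c1.div c2 (Real.Gamma_ne_zero h2)
  exact (c.tendsto.mono_left nhdsWithin_le_nhds).limUnder_eq

/-- General term of the double series, for moneyness `k` and re-scaled volatility `s`. It is used
with `-k / s > 0` only; the middle power in the second summand is a real power. -/
def powerTerm (α q k s : ℝ) (n : ℕ × ℕ) : ℝ :=
  (-1) ^ n.1 / (n.1.factorial : ℝ) * q ^ n.2 *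
    (coeffA α n * (-k / s) ^ n.1 * s ^ n.2
      + 2 * coeffB α n * (-k / s) ^ (2 * (n.1 : ℝ) + 1 + 2 * α) * (-k) ^ n.2)

/-- `C⁻(k, s)`: the double series with its prefactor `F / (2 Γ(τ / ν))`, where `F = K e^{-r τ}`
and `α = τ / ν - 1/2`. -/
def powerSeries (K r ν τ q k s : ℝ) : ℝ :=
  K * Real.exp (-r * τ) / (2 * Real.Gamma (τ / ν)) * ∑' n : ℕ × ℕ, powerTerm (τ / ν - 1 / 2) q k s n

/-- General term of the at-the-money series. -/
def atmTerm (α q s : ℝ) (n : ℕ) : ℝ :=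
  Real.Gamma (((n : ℝ) + 1) / 2 + α) / Real.Gamma ((n : ℝ) / 2 + 1) * (q * s) ^ n

/-- The at-the-money series with its prefactor `F / (2 Γ(τ / ν))`. -/
def atmSeries (K r ν τ q s : ℝ) : ℝ :=
  K * Real.exp (-r * τ) / (2 * Real.Gamma (τ / ν)) * ∑' n : ℕ, atmTerm (τ / ν - 1 / 2) q s n

/-- Discounted risk-neutral `q`-th moment of the terminal price, for the spot price `S`. -/
def discountedMoment (S r q σ ν τ : ℝ) : ℝ :=
  S ^ q * Real.exp (((q - 1) * r + q * martAdj σ ν) * τ)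
    * (1 - q ^ 2 * rescaledVol σ ν ^ 2) ^ (-(τ / ν))

end

end SymVG

namespace SymVG


/-! The moneyness `k` is the coordinate in which `S_T ^ q = K exp (q (k + x))`, where `x` is the
increment of `X` over `(t, T]`. The increment is independent of `ℱ t`, so by the freezing lemma
`condExp_comp_of_indep` the value is `F ∫_{x > -k} exp (q (k + x))` against the Variance Gamma law,
and the problem becomes deterministic.

Out of the money, with `κ = -k > 0`, the integral over `(κ, ∞)` is the one over `(0, ∞)` minus the
one over `(0, κ]`. The former is `exp (-q κ)` times a half-line exponential moment, a power series
in `q σ_ν` (`hasSum_setIntegral_exp_vgLaw`). The product of the two series gives the `coeffA` terms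
with `n₁ ≤ n₂`.

On `(0, κ]` the density is used. It is a Bessel integral in `w = x² / (4 σ_ν²)` which, for
non-integer `α`, is the sum of a series in `w ^ j` and one in `w ^ (α + j)`
(`hasSum_besselIntegrand`). Integrated termwise through Beta integrals, the first series gives the
`coeffA` terms with `n₁ > n₂` and the second gives all `coeffB` terms
(`exists_hasSum_setIntegral_Ioc_vgLaw`). For `n₁ - n₂` even and positive, `coeffA` vanishes by the
convention on `1 / Γ`. Hence `hasSum_setIntegral_Ioi_vgLaw`.

At the money only the half-line moment remains. In the money, the integral is the full moment minus
a lower tail, which the symmetry of the law turns into the previous case with `q` replaced by `-q`.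
-/

/-! ### Gamma at integer shifts, and the closed form of `coeffB`. -/

theorem exists_pos_le_abs_sub_int {x : ℝ} (h : ∀ m : ℤ, x ≠ m) :
    ∃ δ : ℝ, 0 < δ ∧ ∀ m : ℤ, δ ≤ |x - m| := by
  refine ⟨|x - round x|, abs_pos.2 (sub_ne_zero.2 (h _)), fun m => round_le x m⟩

/-- Each step of the recurrence from `x - j` to `x - (j + 1)` divides by `x - (j + 1)`, of modulus
at least `1` once `j ≥ x`. So the moduli eventually decrease, and a finite sum of the initial ones
is a bound. -/
theorem exists_abs_Gamma_sub_nat_le {x : ℝ} (h : ∀ m : ℤ, x ≠ m) :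
    ∃ C : ℝ, 0 ≤ C ∧ ∀ j : ℕ, |Real.Gamma (x - j)| ≤ C := by
  obtain ⟨N, hN⟩ := exists_nat_ge x
  have step : ∀ j : ℕ, N ≤ j → |Real.Gamma (x - (j + 1 : ℕ))| ≤ |Real.Gamma (x - j)| := by
    intro j hj
    have hj' : (N : ℝ) ≤ j := by exact_mod_cast hj
    have e : Real.Gamma (x - j) = (x - (j + 1 : ℕ)) * Real.Gamma (x - (j + 1 : ℕ)) := by
      rw [← Real.Gamma_add_one]
      · congr 1; push_cast; ring
      · exact sub_ne_zero.2 (by exact_mod_cast h ((j : ℤ) + 1))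
    rw [e, abs_mul]
    refine le_mul_of_one_le_left (abs_nonneg _) ?_
    rw [le_abs]; right; push_cast; linarith
  have tail : ∀ i : ℕ, |Real.Gamma (x - (N + i : ℕ))| ≤ |Real.Gamma (x - N)| := by
    intro i
    induction i with
    | zero => simp
    | succ i ih => exact (step _ (Nat.le_add_right _ _)).trans ih
  refine ⟨∑ j ∈ Finset.range (N + 1), |Real.Gamma (x - j)|, by positivity, fun j => ?_⟩
  have single : ∀ i ∈ Finset.range (N + 1), |Real.Gamma (x - i)| ≤
      ∑ j ∈ Finset.range (N + 1), |Real.Gamma (x - j)| := fun i hi =>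
    Finset.single_le_sum (f := fun j : ℕ => |Real.Gamma (x - j)|) (fun _ _ => abs_nonneg _) hi
  rcases lt_or_ge j (N + 1) with hj | hj
  · exact single j (Finset.mem_range.2 hj)
  · obtain ⟨i, rfl⟩ := Nat.exists_eq_add_of_le (Nat.le_of_succ_le hj)
    exact (tail i).trans (single N (by simp))

/-- This evaluates the denominators of `coeffA` below the diagonal. The factor `(2 j)!` will match
the Gamma value in the numerator of a Beta integral. -/
theorem Gamma_half_sub_nat_inv (j : ℕ) :
    (Real.Gamma (1 / 2 - j))⁻¹ = (2 * j).factorial * (-1) ^ j / (j.factorial * 4 ^ j * √Real.pi) := by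
  have hpi : √Real.pi ≠ 0 := by positivity
  induction j with
  | zero => simp; rw [← one_div, Real.Gamma_one_half_eq]
  | succ j ih =>
    have hne : (1 / 2 - ((j : ℝ) + 1)) ≠ 0 := by
      have : (0 : ℝ) ≤ j := by positivity
      linarith
    have e : Real.Gamma (1 / 2 - (j : ℝ)) =
        (1 / 2 - ((j : ℝ) + 1)) * Real.Gamma (1 / 2 - ((j : ℝ) + 1)) := by
      rw [← Real.Gamma_add_one hne]; congr 1; ring
    rw [e, mul_inv] at ih
    push_cast
    have : (Real.Gamma (1 / 2 - ((j : ℝ) + 1)))⁻¹ = (1 / 2 - ((j : ℝ) + 1)) *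
        ((2 * j).factorial * (-1) ^ j / (j.factorial * 4 ^ j * √Real.pi)) := by
      rw [← ih, mul_inv_cancel_left₀ hne]
    rw [this, show 2 * (j + 1) = 2 * j + 1 + 1 by ring, Nat.factorial_succ, Nat.factorial_succ,
      Nat.factorial_succ]
    push_cast
    have := j.factorial_ne_zero
    field_simp
    ring

/-- Euler's reflection formula on both sides, with `sin (π z - m π) = (-1) ^ m sin (π z)`. At
integers both sides are `0`, since division by `0` gives `0`. -/
theorem Gamma_sub_nat_mul_reflect {z : ℝ} (m : ℕ) :
    Real.Gamma (z - m) * Real.Gamma (1 - z + m) =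
      (-1) ^ m * (Real.Gamma z * Real.Gamma (1 - z)) := by
  rw [show 1 - z + (m : ℝ) = 1 - (z - m) by ring, Real.Gamma_mul_Gamma_one_sub,
    Real.Gamma_mul_Gamma_one_sub, mul_sub, mul_comm Real.pi (m : ℝ), Real.sin_sub_nat_mul_pi]
  rcases neg_one_pow_eq_or ℝ m with h | h <;> rw [h] <;> simp [div_neg]

theorem Gamma_div_Gamma_half {z : ℝ} (h : Real.Gamma (z / 2 + 1 / 2) ≠ 0) :
    Real.Gamma z / Real.Gamma (z / 2 + 1 / 2) = Real.Gamma (z / 2) * 2 ^ (z - 1) / √Real.pi := by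
  have := Real.Gamma_mul_Gamma_add_half (z / 2)
  rw [mul_div_cancel₀ _ (two_ne_zero' ℝ)] at this
  have hpi : √Real.pi ≠ 0 := by positivity
  have h2 : (2 : ℝ) ^ (1 - z) * 2 ^ (z - 1) = 1 := by
    rw [← Real.rpow_add two_pos]; simp
  rw [div_eq_div_iff h hpi]
  linear_combination (-2 ^ (z - 1)) * this - Real.Gamma z * √Real.pi * h2

/-- The closed form of `coeffB`, free of removable singularities. -/
noncomputable def coeffBReg (n : ℕ × ℕ) (α : ℝ) : ℝ :=
  -(-1) ^ n.2 * Real.Gamma (-α - n.1) * 2 ^ (-2 * α - 2 * n.1 - 1) / √Real.pi *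
    Real.Gamma (2 * n.1 + 2 * α + 1) / Real.Gamma (n.2 + 2 * n.1 + 2 * α + 2)

/-- Reflection trades the shift by `n₂ + 1` for Gamma values at positive arguments. Legendre
duplication then cancels the denominator and leaves `Γ(-α - n₁)`, whose poles lie only at integers
`α`, not at half-integers. -/
theorem coeffBQuot_eq_coeffBReg {α : ℝ} (hα : -(1 / 2) < α) (h : ∀ m : ℤ, 2 * α ≠ m) (n : ℕ × ℕ) :
    coeffBQuot n α = coeffBReg n α := by
  have h1 : Real.Gamma ((-2 * α - 2 * n.1) / 2 + 1 / 2) ≠ 0 := by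
    refine Real.Gamma_ne_zero fun m hm => h (2 * m - 2 * n.1 + 1) ?_
    push_cast; linarith
  have h0 : (0 : ℝ) ≤ n.1 := by positivity
  have h0' : (0 : ℝ) ≤ n.2 := by positivity
  have h2 : 0 < Real.Gamma (n.2 + 2 * n.1 + 2 * α + 2) := Real.Gamma_pos_of_pos (by linarith)
  have r := Gamma_sub_nat_mul_reflect (z := -2 * α - 2 * n.1) (n.2 + 1)
  have d := Gamma_div_Gamma_half h1
  rw [show 1 - (-2 * α - 2 * (n.1 : ℝ)) + (n.2 + 1 : ℕ) = n.2 + 2 * n.1 + 2 * α + 2 by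
    push_cast; ring, show -2 * α - 2 * (n.1 : ℝ) - (n.2 + 1 : ℕ) = -2 * n.1 - n.2 - 1 - 2 * α by
    push_cast; ring, show 1 - (-2 * α - 2 * (n.1 : ℝ)) = 2 * n.1 + 2 * α + 1 by ring] at r
  rw [show (-2 * α - 2 * (n.1 : ℝ)) / 2 = -α - n.1 by ring] at d h1
  unfold coeffBQuot coeffBReg
  rw [show -(n.1 : ℝ) + 1 / 2 - α = -α - n.1 + 1 / 2 by ring, eq_div_of_mul_eq h2.ne' r]
  have : (-1 : ℝ) ^ (n.2 + 1) * (Real.Gamma (-2 * α - 2 * n.1) * Real.Gamma (2 * n.1 + 2 * α + 1)) /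
      Real.Gamma (n.2 + 2 * n.1 + 2 * α + 2) / Real.Gamma (-α - n.1 + 1 / 2) =
      (-1) ^ (n.2 + 1) * (Real.Gamma (-2 * α - 2 * n.1) / Real.Gamma (-α - n.1 + 1 / 2)) *
      Real.Gamma (2 * n.1 + 2 * α + 1) / Real.Gamma (n.2 + 2 * n.1 + 2 * α + 2) := by
    ring
  rw [this, d]
  ring

theorem continuousAt_coeffBReg {α : ℝ} (hα : -(1 / 2) < α) (h : ∀ m : ℤ, α ≠ m) (n : ℕ × ℕ) :
    ContinuousAt (coeffBReg n) α := by
  have h0 : (0 : ℝ) ≤ n.1 := by positivity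
  have h0' : (0 : ℝ) ≤ n.2 := by positivity
  have c1 : ContinuousAt (fun a : ℝ => Real.Gamma (-a - n.1)) α :=
    ContinuousAt.comp (f := fun a : ℝ => -a - (n.1 : ℝ))
      (Real.differentiableAt_Gamma fun m hm => h (m - n.1) (by push_cast; linarith)).continuousAt
      (by fun_prop)
  have c2 : ContinuousAt (fun a : ℝ => Real.Gamma (2 * n.1 + 2 * a + 1)) α :=
    ContinuousAt.comp (f := fun a : ℝ => 2 * (n.1 : ℝ) + 2 * a + 1)
      (Real.differentiableAt_Gamma fun m hm => by
        have : (0 : ℝ) ≤ m := by positivity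
        linarith).continuousAt (by fun_prop)
  have c3 : ContinuousAt (fun a : ℝ => Real.Gamma (n.2 + 2 * n.1 + 2 * a + 2)) α :=
    ContinuousAt.comp (f := fun a : ℝ => (n.2 : ℝ) + 2 * n.1 + 2 * a + 2)
      (Real.differentiableAt_Gamma fun m hm => by
        have : (0 : ℝ) ≤ m := by positivity
        linarith).continuousAt (by fun_prop)
  have c4 : ContinuousAt (fun a : ℝ => (2 : ℝ) ^ (-2 * a - 2 * n.1 - 1)) α :=
    ContinuousAt.rpow (by fun_prop) (by fun_prop) (Or.inl two_ne_zero)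
  exact ((((continuousAt_const.mul c1).mul c4).div_const _).mul c2).div c3
    (Real.Gamma_pos_of_pos (by linarith)).ne'

theorem eventually_two_mul_ne_int (α : ℝ) : ∀ᶠ a : ℝ in 𝓝[≠] α, ∀ m : ℤ, 2 * a ≠ m := by
  by_cases h : ∃ m : ℤ, 2 * α = m
  · obtain ⟨k, hk⟩ := h
    have : Set.Ioo (α - 1 / 2) (α + 1 / 2) ∈ 𝓝[≠] α :=
      mem_nhdsWithin_of_mem_nhds (Ioo_mem_nhds (by linarith) (by linarith))
    filter_upwards [this, self_mem_nhdsWithin] with a ha hne m hm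
    have h1 : (k : ℝ) - 1 < m := by have := ha.1; linarith
    have h2 : (m : ℝ) < k + 1 := by have := ha.2; linarith
    have h1' : k - 1 < m := by exact_mod_cast h1
    have h2' : m < k + 1 := by exact_mod_cast h2
    obtain rfl : m = k := by omega
    exact hne (by simp; linarith)
  · push Not at h
    obtain ⟨δ, hδ, hd⟩ := exists_pos_le_abs_sub_int h
    have : Set.Ioo (α - δ / 2) (α + δ / 2) ∈ 𝓝[≠] α :=
      mem_nhdsWithin_of_mem_nhds (Ioo_mem_nhds (by linarith) (by linarith))
    filter_upwards [this] with a ha m hm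
    have := hd m
    rw [← hm] at this
    have h3 : |2 * α - 2 * a| < δ := by rw [abs_lt]; constructor <;> linarith [ha.1, ha.2]
    linarith

/-- The quotient and its closed form agree on a punctured neighbourhood of `α`, and the closed form
is continuous at `α` even when `2 α` is an odd integer, that is, when `τ / ν` is an integer. -/
theorem coeffB_eq_coeffBReg {α : ℝ} (hα : -(1 / 2) < α) (h : ∀ m : ℤ, α ≠ m) (n : ℕ × ℕ) :
    coeffB α n = coeffBReg n α := by
  have c : Tendsto (coeffBReg n) (𝓝[≠] α) (𝓝 (coeffBReg n α)) :=
    (continuousAt_coeffBReg hα h n).tendsto.mono_left nhdsWithin_le_nhds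
  refine (c.congr' ?_).limUnder_eq
  have : Set.Ioi (-(1 / 2) : ℝ) ∈ 𝓝[≠] α := mem_nhdsWithin_of_mem_nhds (Ioi_mem_nhds hα)
  filter_upwards [this, eventually_two_mul_ne_int α] with a ha ha'
  exact (coeffBQuot_eq_coeffBReg ha ha' n).symm


/-! ### Expansion of the upper incomplete Gamma function. -/

theorem hasSum_exp (x : ℝ) : HasSum (fun n : ℕ => x ^ n / n.factorial) (Real.exp x) := by
  rw [Real.exp_eq_exp_ℝ]; exact NormedSpace.expSeries_div_hasSum_exp x

/-- Dominated convergence with a majorant that separates the index from the variable; this shape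
covers most termwise integrations below. -/
theorem hasSum_integral_of_le_mul {ι X : Type*} [Countable ι] [MeasurableSpace X] {μ : Measure X}
    {F : ι → X → ℝ} {f g : X → ℝ} {b : ι → ℝ} (hF : ∀ i, AEStronglyMeasurable (F i) μ)
    (hg : Integrable g μ) (hb : Summable b) (hle : ∀ᵐ x ∂μ, ∀ i, |F i x| ≤ b i * g x)
    (hf : ∀ᵐ x ∂μ, HasSum (fun i => F i x) (f x)) :
    HasSum (fun i => ∫ x, F i x ∂μ) (∫ x, f x ∂μ) := by
  refine hasSum_integral_of_dominated_convergence (fun i x => b i * g x) hF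
    (fun i => hle.mono fun x hx => hx i) (ae_of_all _ fun x => hb.mul_right _) ?_ hf
  simp_rw [tsum_mul_right]
  exact hg.const_mul _

/-- The upper incomplete Gamma function. -/
noncomputable def upperGamma (s x : ℝ) : ℝ := ∫ v in Set.Ioi x, Real.exp (-v) * v ^ (s - 1)

theorem integrableOn_exp_neg_mul_rpow (s : ℝ) {x : ℝ} (hx : 0 < x) :
    IntegrableOn (fun v : ℝ => Real.exp (-v) * v ^ s) (Set.Ioi x) :=
  integrable_of_isBigO_exp_neg one_half_pos
    (continuousOn_id.neg.rexp.mul (continuousOn_id.rpow_const fun _ hv =>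
      Or.inl (hx.trans_le hv).ne')) (Real.Gamma_integrand_isLittleO _).isBigO

/-- Integration by parts. As `x > 0` keeps the range away from the singularity at `0`, no sign
condition on `s` is needed. -/
theorem upperGamma_add_one (s : ℝ) {x : ℝ} (hx : 0 < x) :
    upperGamma (s + 1) x = x ^ s * Real.exp (-x) + s * upperGamma s x := by
  have hu : ∀ v ∈ Set.Ioi x, HasDerivAt (fun v : ℝ => v ^ s) (s * v ^ (s - 1)) v := fun v hv =>
    Real.hasDerivAt_rpow_const (Or.inl (hx.trans hv).ne')
  have hv : ∀ v ∈ Set.Ioi x, HasDerivAt (fun v : ℝ => -Real.exp (-v)) (Real.exp (-v)) v :=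
    fun v _ => by convert! ((hasDerivAt_id v).neg.exp).neg using 1; simp
  have c : ContinuousAt ((fun v : ℝ => v ^ s) * fun v : ℝ => -Real.exp (-v)) x :=
    (Real.continuousAt_rpow_const _ _ (Or.inl hx.ne')).mul (by fun_prop)
  have ibp := integral_Ioi_mul_deriv_eq_deriv_mul (b' := 0) hu hv
    ((integrableOn_exp_neg_mul_rpow s hx).congr_fun
      (fun v _ => by simp [mul_comm]) measurableSet_Ioi)
    (IntegrableOn.congr_fun ((integrableOn_exp_neg_mul_rpow (s - 1) hx).const_mul (-s))
      (fun v _ => by simp; ring) measurableSet_Ioi)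
    (c.tendsto.mono_left nhdsWithin_le_nhds) (by
      have := (tendsto_rpow_mul_exp_neg_mul_atTop_nhds_zero s 1 one_pos).neg
      simpa [Pi.mul_def] using this)
  unfold upperGamma
  simp only [add_sub_cancel_right]
  rw [← integral_const_mul]
  calc _ = ∫ v in Set.Ioi x, v ^ s * Real.exp (-v) := by simp_rw [mul_comm]
    _ = _ := ibp
    _ = _ := by
      simp only [Pi.mul_apply, mul_neg, sub_neg_eq_add, zero_add, integral_neg]
      congr 2; ext v; ring

theorem hasSum_upperGamma_of_pos {s x : ℝ} (hs : 0 < s) (hx : 0 < x) :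
    HasSum (fun k : ℕ => (-1) ^ k * x ^ (s + k) / (k.factorial * (s + k)))
      (Real.Gamma s - upperGamma s x) := by
  have split : Real.Gamma s - upperGamma s x =
      ∫ v in Set.Ioc 0 x, Real.exp (-v) * v ^ (s - 1) := by
    have h := Real.GammaIntegral_convergent hs
    rw [Real.Gamma_eq_integral hs, upperGamma, sub_eq_iff_eq_add,
      ← setIntegral_union (Set.Ioc_disjoint_Ioi le_rfl) measurableSet_Ioi
        (h.mono_set Set.Ioc_subset_Ioi_self) (h.mono_set (Set.Ioi_subset_Ioi hx.le)),
      Set.Ioc_union_Ioi_eq_Ioi hx.le]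
  rw [split]
  have hg : IntegrableOn (fun v : ℝ => v ^ (s - 1)) (Set.Ioc 0 x) :=
    (intervalIntegral.intervalIntegrable_rpow' (by linarith)).1
  have key := hasSum_integral_of_le_mul (μ := volume.restrict (Set.Ioc 0 x))
    (F := fun (k : ℕ) v => (-1) ^ k / k.factorial * v ^ (s - 1 + k))
    (f := fun v => Real.exp (-v) * v ^ (s - 1)) (b := fun k => x ^ k / k.factorial)
    (fun k => by fun_prop) hg (Real.summable_pow_div_factorial x)
    ((ae_restrict_mem measurableSet_Ioc).mono fun v hv k => by
      rw [Real.rpow_add hv.1, Real.rpow_natCast, abs_mul, abs_div, abs_pow, abs_neg, abs_one,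
        one_pow, abs_of_pos (by positivity : (0 : ℝ) < k.factorial),
        abs_of_nonneg (mul_nonneg (Real.rpow_nonneg hv.1.le _) (pow_nonneg hv.1.le _))]
      have h1 := pow_le_pow_left₀ hv.1.le hv.2 k
      have h0 := Real.rpow_nonneg hv.1.le (s - 1)
      rw [div_mul_eq_mul_div, div_mul_eq_mul_div]
      exact div_le_div_of_nonneg_right (by nlinarith) (by positivity))
    ((ae_restrict_mem measurableSet_Ioc).mono fun v hv => by
      refine ((hasSum_exp (-v)).mul_right (v ^ (s - 1))).congr_fun fun k => ?_
      rw [Real.rpow_add hv.1, Real.rpow_natCast, neg_pow]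
      ring)
  refine key.congr_fun fun k => ?_
  rw [integral_const_mul, ← intervalIntegral.integral_of_le hx.le,
    integral_rpow (Or.inl (by have : (0 : ℝ) ≤ k := by positivity
                              linarith))]
  rw [show s - 1 + (k : ℝ) + 1 = s + k by ring, Real.zero_rpow (by positivity)]
  field_simp
  simp

theorem hasSum_upperGamma {s x : ℝ} (hs : ∀ m : ℤ, s ≠ m) (hx : 0 < x) :
    HasSum (fun k : ℕ => (-1) ^ k * x ^ (s + k) / (k.factorial * (s + k)))
      (Real.Gamma s - upperGamma s x) := by
  obtain ⟨N, hN⟩ := exists_nat_gt (-s)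
  induction N generalizing s with
  | zero => exact hasSum_upperGamma_of_pos (by simpa using hN) hx
  | succ N ih =>
    have h := ih (s := s + 1) (fun m hm => hs (m - 1) (by push_cast; linarith))
      (by push_cast at hN; linarith)
    have hs0 : s ≠ 0 := by simpa using hs 0
    rw [Real.Gamma_add_one hs0, upperGamma_add_one s hx] at h
    -- Write `a_k` for the term at `s`. Then `-k a_k` is the term of index `k - 1` at `s + 1`, and
    -- vanishes for `k = 0`, while `(s + k) a_k` is a term of `x ^ s exp (-x)`. Since `s a_k = (s +
    -- k) a_k - k a_k`, the expansion descends from `s + 1` to `s`.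
    have hshift : HasSum (fun k : ℕ => -((-1) ^ k * x ^ (s + k) / (k.factorial * (s + k)) * k))
        (s * Real.Gamma s - (x ^ s * Real.exp (-x) + s * upperGamma s x)) := by
      rw [← hasSum_nat_add_iff' 1]
      simp only [Finset.range_one, Finset.sum_singleton, Nat.cast_zero, mul_zero, neg_zero,
        sub_zero]
      refine h.congr_fun fun k => ?_
      have hk : s + 1 + k ≠ 0 := by
        have := hs (-1 - k)
        push_cast at this
        intro h; exact this (by linarith)
      have hk' : s + (k + 1) ≠ 0 := by rwa [add_comm (k : ℝ), ← add_assoc]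
      rw [Nat.factorial_succ]
      push_cast
      rw [show s + 1 + (k : ℝ) = s + (k + 1) by ring]
      field_simp
      ring
    have := ((hshift.add ((hasSum_exp (-x)).mul_left (x ^ s))).div_const s)
    convert! this using 1
    · ext k
      have hk : s + k ≠ 0 := by
        have := hs (-k)
        push_cast at this
        intro h; exact this (by linarith)
      rw [Real.rpow_add hx, Real.rpow_natCast, neg_pow]
      field_simp
      ring
    · field_simp
      ring


/-! ### The Bessel integral and its expansion at `0`. -/

/-- The integrand `e^{-u - w / u} u^{β - 1}` of the modified Bessel function of the second kind. -/
noncomputable def besselIntegrand (β w u : ℝ) : ℝ :=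
  Real.exp (-u) * u ^ (β - 1) * Real.exp (-(w / u))

theorem measurable_besselIntegrand (β w : ℝ) : Measurable (besselIntegrand β w) := by
  unfold besselIntegrand; fun_prop

theorem besselIntegrand_nonneg (β w : ℝ) {u : ℝ} (hu : 0 ≤ u) : 0 ≤ besselIntegrand β w u := by
  unfold besselIntegrand; positivity

theorem integrableOn_besselIntegrand_Ioi (β : ℝ) {w c : ℝ} (hw : 0 ≤ w) (hc : 0 < c) :
    IntegrableOn (besselIntegrand β w) (Set.Ioi c) := by
  refine Integrable.mono' (integrableOn_exp_neg_mul_rpow (β - 1) hc)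
    (measurable_besselIntegrand β w).aestronglyMeasurable
    ((ae_restrict_mem measurableSet_Ioi).mono fun u hu => ?_)
  have hu0 : 0 < u := hc.trans hu
  rw [Real.norm_of_nonneg (besselIntegrand_nonneg β w hu0.le)]
  refine mul_le_of_le_one_right (by positivity) (Real.exp_le_one_iff.2 ?_)
  simp only [Left.neg_nonpos_iff]; positivity

theorem image_div_Ioi {w : ℝ} (hw : 0 < w) : (fun t : ℝ => w / t) '' Set.Ioi w = Set.Ioo 0 1 := by
  ext u
  constructor
  · rintro ⟨t, ht, rfl⟩
    have ht0 : 0 < t := hw.trans ht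
    exact ⟨div_pos hw ht0, (div_lt_one ht0).2 ht⟩
  · rintro ⟨h0, h1⟩
    refine ⟨w / u, ?_, by field_simp⟩
    rw [Set.mem_Ioi, lt_div_iff₀ h0]
    nlinarith

/-- The substitution `u = w / t` exchanges the exponents `u` and `w / u`, at the cost of the sign of
`β` and a factor `w ^ β`. -/
theorem abs_deriv_smul_besselIntegrand (β : ℝ) {w t : ℝ} (hw : 0 < w) (ht : 0 < t) :
    |(-w / t ^ 2)| • besselIntegrand β w (w / t) = w ^ β * besselIntegrand (-β) w t := by
  unfold besselIntegrand
  rw [smul_eq_mul, abs_div, abs_neg, abs_of_pos hw, abs_of_pos (by positivity : 0 < t ^ 2),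
    div_div_cancel₀ hw.ne', Real.div_rpow hw.le ht.le, Real.rpow_sub_one hw.ne',
    Real.rpow_sub_one ht.ne', Real.rpow_sub_one ht.ne', Real.rpow_neg ht.le]
  have := (Real.rpow_pos_of_pos ht β).ne'
  field_simp

theorem hasDerivWithinAt_const_div {w t : ℝ} (s : Set ℝ) (ht : t ≠ 0) :
    HasDerivWithinAt (fun t : ℝ => w / t) (-w / t ^ 2) s t := by
  simpa [div_eq_mul_inv] using ((hasDerivAt_inv ht).const_mul w).hasDerivWithinAt

theorem injOn_const_div_Ioi {w : ℝ} (hw : 0 < w) : Set.InjOn (fun t : ℝ => w / t) (Set.Ioi w) := by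
  intro a ha b hb h
  have ha0 : a ≠ 0 := (hw.trans ha).ne'
  have hb0 : b ≠ 0 := (hw.trans hb).ne'
  simp only at h
  field_simp at h
  exact h.symm

theorem integrableOn_besselIntegrand_Ioo (β : ℝ) {w : ℝ} (hw : 0 < w) :
    IntegrableOn (besselIntegrand β w) (Set.Ioo 0 1) := by
  rw [← image_div_Ioi hw, integrableOn_image_iff_integrableOn_abs_deriv_smul measurableSet_Ioi
    (fun t ht => hasDerivWithinAt_const_div _ (hw.trans ht).ne') (injOn_const_div_Ioi hw)]
  exact IntegrableOn.congr_fun ((integrableOn_besselIntegrand_Ioi (-β) hw.le hw).const_mul (w ^ β))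
    (fun t ht => (abs_deriv_smul_besselIntegrand β hw (hw.trans ht)).symm) measurableSet_Ioi

theorem integral_besselIntegrand_Ioo (β : ℝ) {w : ℝ} (hw : 0 < w) :
    ∫ u in Set.Ioo 0 1, besselIntegrand β w u =
      w ^ β * ∫ u in Set.Ioi w, besselIntegrand (-β) w u := by
  rw [← image_div_Ioi hw, integral_image_eq_integral_abs_deriv_smul measurableSet_Ioi
    (fun t ht => hasDerivWithinAt_const_div _ (hw.trans ht).ne') (injOn_const_div_Ioi hw),
    ← integral_const_mul]
  exact setIntegral_congr_fun measurableSet_Ioi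
    (fun t ht => abs_deriv_smul_besselIntegrand β hw (hw.trans ht))

theorem Ioo_union_Ici_eq_Ioi_zero : Set.Ioo (0 : ℝ) 1 ∪ Set.Ici 1 = Set.Ioi 0 :=
  Set.Ioo_union_Ici_eq_Ioi one_pos

theorem integrableOn_besselIntegrand (β : ℝ) {w : ℝ} (hw : 0 < w) :
    IntegrableOn (besselIntegrand β w) (Set.Ioi 0) := by
  rw [← Ioo_union_Ici_eq_Ioi_zero, integrableOn_union, integrableOn_Ici_iff_integrableOn_Ioi]
  exact ⟨integrableOn_besselIntegrand_Ioo β hw, integrableOn_besselIntegrand_Ioi β hw.le one_pos⟩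

/-- Inverting the part over `(0, 1)` leaves two integrals away from `0`, where `exp (-(w / u))` may
be expanded under the integral sign. -/
theorem integral_besselIntegrand (β : ℝ) {w : ℝ} (hw : 0 < w) :
    ∫ u in Set.Ioi 0, besselIntegrand β w u =
      (∫ u in Set.Ioi 1, besselIntegrand β w u) +
        w ^ β * ∫ u in Set.Ioi w, besselIntegrand (-β) w u := by
  rw [← Ioo_union_Ici_eq_Ioi_zero, setIntegral_union
    (Set.disjoint_left.2 fun u hu hu' => hu.2.not_ge hu') measurableSet_Ici
    (integrableOn_besselIntegrand_Ioo β hw)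
    ((integrableOn_Ici_iff_integrableOn_Ioi (by finiteness)).2
      (integrableOn_besselIntegrand_Ioi β hw.le one_pos)),
    integral_besselIntegrand_Ioo β hw, integral_Ici_eq_integral_Ioi, add_comm]

/-- On `u > c` the ratio `w / u` is at most `w / c`, so the exponential series is dominated
uniformly, and each term integrates to an incomplete Gamma value. -/
theorem hasSum_besselIntegrand_Ioi (β : ℝ) {w c : ℝ} (hw : 0 ≤ w) (hc : 0 < c) :
    HasSum (fun j : ℕ => (-w) ^ j / j.factorial * upperGamma (β - j) c)
      (∫ u in Set.Ioi c, besselIntegrand β w u) := by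
  have key := hasSum_integral_of_le_mul (μ := volume.restrict (Set.Ioi c))
    (F := fun (j : ℕ) u => (-w) ^ j / j.factorial * (Real.exp (-u) * u ^ (β - j - 1)))
    (f := besselIntegrand β w) (b := fun j => (w / c) ^ j / j.factorial)
    (fun k => by fun_prop) (integrableOn_exp_neg_mul_rpow (β - 1) hc)
    (Real.summable_pow_div_factorial _)
    ((ae_restrict_mem measurableSet_Ioi).mono fun u hu j => by
      have hu0 : 0 < u := hc.trans hu
      rw [show β - j - 1 = β - 1 - j by ring, Real.rpow_sub hu0, Real.rpow_natCast, abs_mul,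
        abs_div, abs_pow, abs_neg, abs_of_nonneg hw,
        abs_of_pos (by positivity : (0 : ℝ) < j.factorial),
        abs_of_pos (by positivity : 0 < Real.exp (-u) * (u ^ (β - 1) / u ^ j))]
      have h1 : (w / u) ^ j ≤ (w / c) ^ j :=
        pow_le_pow_left₀ (by positivity) (div_le_div_of_nonneg_left hw hc (le_of_lt hu)) j
      calc w ^ j / j.factorial * (Real.exp (-u) * (u ^ (β - 1) / u ^ j))
          = (w / u) ^ j / j.factorial * (Real.exp (-u) * u ^ (β - 1)) := by
            rw [div_pow]; field_simp
        _ ≤ _ := mul_le_mul_of_nonneg_right (div_le_div_of_nonneg_right h1 (by positivity))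
            (by positivity))
    ((ae_restrict_mem measurableSet_Ioi).mono fun u hu => by
      have hu0 : 0 < u := hc.trans hu
      refine ((hasSum_exp (-(w / u))).mul_left (Real.exp (-u) * u ^ (β - 1))).congr_fun
        fun j => ?_
      rw [show β - j - 1 = β - 1 - j by ring, Real.rpow_sub hu0, Real.rpow_natCast, neg_pow,
        neg_pow (w / u), div_pow]
      field_simp)
  simpa only [integral_const_mul, upperGamma] using! key

/-- Series expansion at `0` of `∫ e^{-u - w / u} u^{α - 1} du = 2 w^{α / 2} K_α (2 √w)`. -/
theorem hasSum_besselIntegrand {α w : ℝ} (hα : ∀ m : ℤ, α ≠ m) (hw : 0 < w) :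
    HasSum (fun j : ℕ => (-1) ^ j / (j.factorial : ℝ) *
      (Real.Gamma (α - j) * w ^ j + Real.Gamma (-α - j) * w ^ (α + j)))
      (∫ u in Set.Ioi 0, besselIntegrand α w u) := by
  obtain ⟨δ, hδ, hd⟩ := exists_pos_le_abs_sub_int hα
  -- These are the corrections between the incomplete and the complete Gamma values. Summed by rows
  -- they complete `Γ(α - j, 1)`, and summed by columns, with the opposite sign, they complete `Γ(-α
  -- - j, w)`. The two totals cancel, provided `D` is summable.
  let D : ℕ × ℕ → ℝ := fun p =>
    (-w) ^ p.1 / p.1.factorial * ((-1) ^ p.2 / (p.2.factorial * (α - p.1 + p.2)))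
  have hne : ∀ j k : ℕ, α - j + k ≠ 0 := fun j k h => hα (j - k) (by push_cast; linarith)
  have hD : Summable D := by
    have hs := ((Real.summable_pow_div_factorial w).mul_of_nonneg
      (Real.summable_pow_div_factorial 1) (fun _ => by positivity)
      (fun _ => by positivity)).mul_left δ⁻¹
    -- The denominators `α - j + k` stay at distance at least `δ` from `0`, so two exponential
    -- series dominate.
    refine Summable.of_norm_bounded hs fun p => ?_
    have h1 : δ ≤ |α - p.1 + p.2| := by
      have := hd (p.1 - p.2)
      push_cast at this
      rwa [sub_add]
    simp only [D]
    rw [Real.norm_eq_abs, abs_mul, abs_div, abs_div, abs_mul, abs_pow, abs_pow, abs_neg, abs_neg,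
      abs_one, abs_of_pos hw, one_pow, Nat.abs_cast, Nat.abs_cast]
    have h2 : 1 / (p.2.factorial * |α - p.1 + p.2|) ≤ 1 / (p.2.factorial * δ) := by gcongr
    calc _ ≤ w ^ p.1 / p.1.factorial * (1 / (p.2.factorial * δ)) := by gcongr
      _ = _ := by field_simp
  have h1 : HasSum (fun j : ℕ => (-1) ^ j / (j.factorial : ℝ) * (Real.Gamma (α - j) * w ^ j))
      ((∫ u in Set.Ioi 1, besselIntegrand α w u) + ∑' p, D p) := by
    have hrow : ∀ j : ℕ, HasSum (fun k => D (j, k))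
        ((-w) ^ j / j.factorial * (Real.Gamma (α - j) - upperGamma (α - j) 1)) := fun j => by
      have := hasSum_upperGamma (s := α - j) (x := 1)
        (fun m hm => hα (m + j) (by push_cast; linarith)) one_pos
      simpa [D] using this.mul_left ((-w) ^ j / (j.factorial : ℝ))
    refine ((hasSum_besselIntegrand_Ioi α hw.le one_pos).add
      (hD.hasSum.prod_fiberwise hrow)).congr_fun fun j => ?_
    rw [neg_pow]
    ring
  have h2 : HasSum (fun j : ℕ => (-1) ^ j / (j.factorial : ℝ) *
      (Real.Gamma (-α - j) * w ^ (α + j)))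
      (w ^ α * (∫ u in Set.Ioi w, besselIntegrand (-α) w u) - ∑' p, D p) := by
    have hD' : HasSum (fun p : ℕ × ℕ => -D p.swap) (-∑' p, D p) :=
      ((Equiv.prodComm ℕ ℕ).hasSum_iff.2 hD.hasSum).neg
    have hrow : ∀ j : ℕ, HasSum (fun k => -D (j, k).swap) (w ^ α * ((-w) ^ j / j.factorial) *
        (Real.Gamma (-α - j) - upperGamma (-α - j) w)) := fun j => by
      have := hasSum_upperGamma (s := -α - j) (x := w)
        (fun m hm => hα (-m - j) (by push_cast; linarith)) hw
      refine (this.mul_left (w ^ α * ((-w) ^ j / (j.factorial : ℝ)))).congr_fun fun k => ?_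
      have e : α - k + j = -(-α - j + k) := by ring
      have hn : -α - j + k ≠ 0 := by
        have := hne k j
        rw [e] at this
        exact neg_ne_zero.1 this
      simp only [D, Prod.swap]
      rw [e, show -α - j + (k : ℝ) = -α + k - j by ring, Real.rpow_sub hw, Real.rpow_add hw,
        Real.rpow_neg hw.le, Real.rpow_natCast, Real.rpow_natCast,
        show -α + (k : ℝ) - j = -α - j + k by ring]
      have := (Real.rpow_pos_of_pos hw α).ne'
      field_simp
      rw [neg_pow w k, neg_pow w j]
      ring
    have hb := ((hasSum_besselIntegrand_Ioi (-α) hw.le hw).mul_left (w ^ α)).add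
      (hD'.prod_fiberwise hrow)
    rw [sub_eq_add_neg]
    refine hb.congr_fun fun j => ?_
    rw [neg_pow, Real.rpow_add hw, Real.rpow_natCast]
    ring
  rw [integral_besselIntegrand α hw]
  convert! h1.add h2 using 1
  · ext j; ring
  · ring


/-! ### Density of the Variance Gamma law. -/

theorem rescaledVol_pos {σ ν : ℝ} (hσ : 0 < σ) (hν : 0 < ν) : 0 < rescaledVol σ ν := by
  unfold rescaledVol; positivity

theorem rescaledVol_sq (σ : ℝ) {ν : ℝ} (hν : 0 < ν) : rescaledVol σ ν ^ 2 = σ ^ 2 * (ν / 2) := by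
  rw [rescaledVol, mul_pow, Real.sq_sqrt (by positivity)]

/-- Density of the symmetric Variance Gamma law whose Gamma time has shape `a`. -/
noncomputable def vgDensity (σ ν a x : ℝ) : ℝ :=
  (∫ u in Set.Ioi 0, besselIntegrand (a - 1 / 2) (x ^ 2 / (4 * rescaledVol σ ν ^ 2)) u) /
    (2 * rescaledVol σ ν * √Real.pi * Real.Gamma a)

theorem measurable_vgDensity (σ ν a : ℝ) : Measurable (vgDensity σ ν a) := by
  unfold vgDensity
  refine Measurable.div_const (StronglyMeasurable.measurable ?_) _
  refine StronglyMeasurable.integral_prod_right' (f := fun p : ℝ × ℝ =>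
    besselIntegrand (a - 1 / 2) (p.1 ^ 2 / (4 * rescaledVol σ ν ^ 2)) p.2) ?_
  refine Measurable.stronglyMeasurable ?_
  unfold besselIntegrand
  fun_prop

theorem vgDensity_nonneg {σ ν a : ℝ} (hσ : 0 < σ) (hν : 0 < ν) (ha : 0 < a) (x : ℝ) :
    0 ≤ vgDensity σ ν a x := by
  have hs := rescaledVol_pos hσ hν
  have := Real.Gamma_pos_of_pos ha
  refine div_nonneg (setIntegral_nonneg measurableSet_Ioi fun u hu =>
    besselIntegrand_nonneg _ _ (le_of_lt hu)) (by positivity)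

theorem vgDensity_neg (σ ν a x : ℝ) : vgDensity σ ν a (-x) = vgDensity σ ν a x := by
  simp [vgDensity]

/-- With Gamma time `y = ν u` the rate becomes `1` and the Gaussian variance is `2 σ_ν² u`. Its
normalisation contributes `u ^ (-1 / 2)`, which lowers the shape `a` to the Bessel index `a - 1 /
2`; the leading `ν` is the Jacobian. -/
theorem mul_gammaPDFReal_mul_gaussianPDFReal {σ ν a : ℝ} (hσ : 0 < σ) (hν : 0 < ν) (x : ℝ) {u : ℝ}
    (hu : 0 < u) :
    ν * (gammaPDFReal a (1 / ν) (ν * u) * gaussianPDFReal 0 (σ ^ 2 * (ν * u)).toNNReal x) =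
      besselIntegrand (a - 1 / 2) (x ^ 2 / (4 * rescaledVol σ ν ^ 2)) u /
        (2 * rescaledVol σ ν * √Real.pi * Real.Gamma a) := by
  have hs := rescaledVol_pos hσ hν
  have hv : 0 ≤ σ ^ 2 * (ν * u) := by positivity
  have hsq : √(2 * Real.pi * (σ ^ 2 * (ν * u))) = 2 * rescaledVol σ ν * √Real.pi * √u := by
    rw [Real.sqrt_eq_iff_mul_self_eq (by positivity) (by positivity)]
    have e1 := Real.mul_self_sqrt Real.pi_pos.le
    have e2 := Real.mul_self_sqrt hu.le
    have e3 := rescaledVol_sq σ hν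
    linear_combination (-4 * rescaledVol σ ν ^ 2 * √u * √u) * e1 -
      4 * rescaledVol σ ν ^ 2 * Real.pi * e2 - 4 * Real.pi * u * e3
  rw [gammaPDFReal, if_pos (by positivity), gaussianPDFReal, Real.coe_toNNReal _ hv, hsq,
    besselIntegrand, Real.mul_rpow hν.le hu.le, one_div, Real.inv_rpow hν.le, sub_zero,
    Real.rpow_sub_one hν.ne', show a - 1 / 2 - 1 = a - 1 - 1 / 2 by ring, Real.rpow_sub hu (a - 1) (1 / 2),
    ← Real.sqrt_eq_rpow,
    show -x ^ 2 / (2 * (σ ^ 2 * (ν * u))) = -(x ^ 2 / (4 * rescaledVol σ ν ^ 2) / u) by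
      rw [rescaledVol_sq σ hν]; field_simp; norm_num, inv_mul_cancel_left₀ hν.ne']
  have := (Real.rpow_pos_of_pos hν a).ne'
  have := (Real.sqrt_pos.2 hu).ne'
  by_cases hG : Real.Gamma a = 0
  · simp [hG]
  field_simp

theorem integral_gammaPDFReal_mul_gaussianPDFReal {σ ν a : ℝ} (hσ : 0 < σ) (hν : 0 < ν) {x : ℝ}
    (hx : x ≠ 0) :
    IntegrableOn (fun y => gammaPDFReal a (1 / ν) y * gaussianPDFReal 0 (σ ^ 2 * y).toNNReal x)
      (Set.Ioi 0) ∧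
    ∫ y in Set.Ioi 0, gammaPDFReal a (1 / ν) y * gaussianPDFReal 0 (σ ^ 2 * y).toNNReal x =
      vgDensity σ ν a x := by
  have hs := rescaledVol_pos hσ hν
  have hw : 0 < x ^ 2 / (4 * rescaledVol σ ν ^ 2) := by positivity
  constructor
  · have h := integrableOn_Ioi_comp_mul_left_iff (fun y => gammaPDFReal a (1 / ν) y *
      gaussianPDFReal 0 (σ ^ 2 * y).toNNReal x) 0 hν
    rw [mul_zero] at h
    rw [← h]
    refine IntegrableOn.congr_fun (((integrableOn_besselIntegrand (a - 1 / 2) hw).div_const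
      (2 * rescaledVol σ ν * √Real.pi * Real.Gamma a)).const_mul ν⁻¹) (fun u hu => ?_)
      measurableSet_Ioi
    rw [← mul_gammaPDFReal_mul_gaussianPDFReal hσ hν x hu, inv_mul_cancel_left₀ hν.ne']
  · have h := integral_comp_mul_left_Ioi (fun y => gammaPDFReal a (1 / ν) y *
      gaussianPDFReal 0 (σ ^ 2 * y).toNNReal x) 0 hν
    rw [mul_zero, smul_eq_mul, eq_inv_mul_iff_mul_eq₀ hν.ne', ← integral_const_mul] at h
    rw [← h, vgDensity, ← integral_div]
    exact setIntegral_congr_fun measurableSet_Ioi fun u hu =>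
      mul_gammaPDFReal_mul_gaussianPDFReal hσ hν x hu

theorem lintegral_gaussianReal_comp {σ y : ℝ} (hσ : 0 < σ) (hy : 0 < y) {g : ℝ → ENNReal}
    (hg : Measurable g) :
    ∫⁻ z, g (σ * (√y * z)) ∂gaussianReal 0 1 =
      ∫⁻ x, gaussianPDF 0 (σ ^ 2 * y).toNNReal x * g x := by
  have hv : (σ ^ 2 * y).toNNReal ≠ 0 := by
    rw [Ne, Real.toNNReal_eq_zero, not_le]; positivity
  have hmap : (gaussianReal 0 1).map (fun z => σ * √y * z) =
      gaussianReal 0 (σ ^ 2 * y).toNNReal := by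
    rw [gaussianReal_map_const_mul, mul_zero, mul_one]
    congr 1
    ext
    rw [Real.coe_toNNReal _ (by positivity)]
    simp [mul_pow, Real.sq_sqrt hy.le]
  have := lintegral_map (μ := gaussianReal 0 1) hg (measurable_const_mul (σ * √y))
  simp_rw [← mul_assoc]
  rw [← this, hmap, gaussianReal_of_var_ne_zero _ hv,
    lintegral_withDensity_eq_lintegral_mul _ (measurable_gaussianPDF _ _) hg]
  rfl

/-- Conditionally on the Gamma time the law is Gaussian, and Tonelli integrates the time out first.
The point `x = 0` is discarded as a null set, because the integrability of the mixture is
established only for `w > 0`. -/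
theorem vgLaw_eq_withDensity {σ ν t : ℝ} (hσ : 0 < σ) (hν : 0 < ν) (ht : 0 < t) :
    vgLaw σ ν t = volume.withDensity fun x => ENNReal.ofReal (vgDensity σ ν (t / ν) x) := by
  have ha : 0 < t / ν := by positivity
  have hm : Measurable fun p : ℝ × ℝ => σ * (√p.1 * p.2) := by fun_prop
  refine Measure.ext fun s hs => ?_
  let g : ℝ → ENNReal := s.indicator 1
  have hg : Measurable g := measurable_one.indicator hs
  have hgm : Measurable fun p : ℝ × ℝ => g (σ * (√p.1 * p.2)) := hg.comp hm
  have hgam : Measurable (gammaPDF (t / ν) (1 / ν)) :=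
    (measurable_gammaPDFReal _ _).ennreal_ofReal
  have hpdf : Measurable fun p : ℝ × ℝ => gaussianPDF 0 (σ ^ 2 * p.1).toNNReal p.2 :=
    measurable_uncurry_gaussianPDF.comp (f := fun p : ℝ × ℝ => ((0 : ℝ),
      (σ ^ 2 * p.1).toNNReal, p.2)) (by fun_prop)
  have hpos : ∀ y, y ≤ 0 → y ≠ 0 → gammaPDF (t / ν) (1 / ν) y = 0 := fun y h1 h2 =>
    gammaPDF_of_neg (lt_of_le_of_ne h1 h2)
  calc vgLaw σ ν t s = ∫⁻ x, g x ∂vgLaw σ ν t := (lintegral_indicator_one hs).symm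
    _ = ∫⁻ y, ∫⁻ z, g (σ * (√y * z)) ∂gaussianReal 0 1 ∂gammaMeasure (t / ν) (1 / ν) := by
      rw [vgLaw, lintegral_map hg hm, lintegral_prod _ hgm.aemeasurable]
    _ = ∫⁻ y, gammaPDF (t / ν) (1 / ν) y * ∫⁻ z, g (σ * (√y * z)) ∂gaussianReal 0 1 := by
      rw [gammaMeasure, lintegral_withDensity_eq_lintegral_mul _ hgam
        hgm.lintegral_prod_right']
      rfl
    _ = ∫⁻ y in Set.Ioi 0,
          gammaPDF (t / ν) (1 / ν) y * ∫⁻ z, g (σ * (√y * z)) ∂gaussianReal 0 1 := by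
      rw [← lintegral_indicator measurableSet_Ioi]
      refine lintegral_congr_ae ?_
      filter_upwards [Measure.ae_ne volume (0 : ℝ)] with y hy
      by_cases h : 0 < y
      · simp [h]
      · rw [Set.indicator_of_notMem (by simpa using h), hpos y (not_lt.1 h) hy, zero_mul]
    _ = ∫⁻ y in Set.Ioi 0, ∫⁻ x, gammaPDF (t / ν) (1 / ν) y *
          (gaussianPDF 0 (σ ^ 2 * y).toNNReal x * g x) := by
      refine setLIntegral_congr_fun measurableSet_Ioi fun y hy => ?_
      have hpdf' : Measurable fun x => gaussianPDF 0 (σ ^ 2 * y).toNNReal x * g x :=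
        (measurable_gaussianPDF _ _).mul hg
      rw [lintegral_gaussianReal_comp hσ hy hg, lintegral_const_mul _ hpdf']
    _ = ∫⁻ x, ∫⁻ y in Set.Ioi 0, gammaPDF (t / ν) (1 / ν) y *
          (gaussianPDF 0 (σ ^ 2 * y).toNNReal x * g x) := by
      refine lintegral_lintegral_swap (Measurable.aemeasurable ?_)
      exact (hgam.comp measurable_fst).mul (hpdf.mul (hg.comp measurable_snd))
    _ = ∫⁻ x, ENNReal.ofReal (vgDensity σ ν (t / ν) x) * g x := by
      refine lintegral_congr_ae ?_
      filter_upwards [Measure.ae_ne volume (0 : ℝ)] with x hx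
      obtain ⟨hi, he⟩ := integral_gammaPDFReal_mul_gaussianPDFReal (a := t / ν) hσ hν hx
      have hpdf' : Measurable fun y => gammaPDF (t / ν) (1 / ν) y *
          gaussianPDF 0 (σ ^ 2 * y).toNNReal x := hgam.mul (hpdf.comp measurable_prodMk_right)
      simp_rw [← mul_assoc]
      rw [lintegral_mul_const _ hpdf', ← he,
        ofReal_integral_eq_lintegral_ofReal hi (ae_of_all _ fun y =>
          mul_nonneg (gammaPDFReal_nonneg ha (by positivity) _) (gaussianPDFReal_nonneg _ _ _))]
      congr 2
      ext y
      rw [ENNReal.ofReal_mul (gammaPDFReal_nonneg ha (by positivity) _)]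
      rfl
    _ = _ := by
      rw [withDensity_apply _ hs, ← lintegral_indicator hs]
      congr 1
      ext x
      by_cases h : x ∈ s <;> simp [g, h]


/-! ### Exponential and half-line moments. -/

theorem measurable_gammaPDF (a r : ℝ) : Measurable (gammaPDF a r) :=
  (measurable_gammaPDFReal a r).ennreal_ofReal

theorem ae_gammaMeasure_pos (a r : ℝ) : ∀ᵐ y ∂gammaMeasure a r, 0 < y := by
  rw [gammaMeasure, ae_withDensity_iff (measurable_gammaPDF _ _)]
  filter_upwards [Measure.ae_ne volume (0 : ℝ)] with y hy h
  by_contra! hle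
  exact h (gammaPDF_of_neg (lt_of_le_of_ne hle hy))

theorem toReal_gammaPDF_mul {a r : ℝ} (ha : 0 < a) (hr : 0 < r) (f : ℝ → ℝ) :
    (fun y => (gammaPDF a r y).toReal • f y) =ᵐ[volume] (Set.Ioi 0).indicator
      (fun y => r ^ a / Real.Gamma a * (y ^ (a - 1) * Real.exp (-(r * y)) * f y)) := by
  filter_upwards [Measure.ae_ne volume (0 : ℝ)] with y hy
  rw [gammaPDF, ENNReal.toReal_ofReal (gammaPDFReal_nonneg ha hr y), gammaPDFReal, smul_eq_mul]
  by_cases h : 0 < y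
  · rw [if_pos h.le, Set.indicator_of_mem (by simpa using h)]
    ring
  · rw [if_neg (fun h' => h (lt_of_le_of_ne h' hy.symm)), Set.indicator_of_notMem (by simpa using h),
      zero_mul]

theorem integrable_gammaMeasure {a r : ℝ} (ha : 0 < a) (hr : 0 < r) {f : ℝ → ℝ}
    (hf : IntegrableOn (fun y => y ^ (a - 1) * Real.exp (-(r * y)) * f y) (Set.Ioi 0)) :
    Integrable f (gammaMeasure a r) := by
  rw [gammaMeasure, integrable_withDensity_iff_integrable_smul'
    (measurable_gammaPDF _ _) (ae_of_all _ fun _ => ENNReal.ofReal_lt_top),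
    integrable_congr (toReal_gammaPDF_mul ha hr f), integrable_indicator_iff measurableSet_Ioi]
  exact hf.const_mul _

theorem integral_gammaMeasure {a r : ℝ} (ha : 0 < a) (hr : 0 < r) (f : ℝ → ℝ) :
    ∫ y, f y ∂gammaMeasure a r = r ^ a / Real.Gamma a *
      ∫ y in Set.Ioi 0, y ^ (a - 1) * Real.exp (-(r * y)) * f y := by
  rw [gammaMeasure, integral_withDensity_eq_integral_toReal_smul
    (measurable_gammaPDF _ _) (ae_of_all _ fun _ => ENNReal.ofReal_lt_top),
    integral_congr_ae (toReal_gammaPDF_mul ha hr f), integral_indicator measurableSet_Ioi,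
    integral_const_mul]

theorem exp_moment_gammaMeasure {a r b : ℝ} (ha : 0 < a) (hr : 0 < r) (hb : b < r) :
    Integrable (fun y => Real.exp (b * y)) (gammaMeasure a r) ∧
      ∫ y, Real.exp (b * y) ∂gammaMeasure a r = (1 - b / r) ^ (-a) := by
  have hrb : 0 < r - b := by linarith
  have e : ∀ y : ℝ, y ^ (a - 1) * Real.exp (-(r * y)) * Real.exp (b * y) =
      y ^ (a - 1) * Real.exp (-((r - b) * y)) := fun y => by
    rw [mul_assoc, ← Real.exp_add]; ring_nf
  have hv := Real.integral_rpow_mul_exp_neg_mul_Ioi ha hrb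
  have hG := Real.Gamma_pos_of_pos ha
  constructor
  · refine integrable_gammaMeasure ha hr ?_
    simp_rw [e]
    -- A non-integrable function has Bochner integral `0`, so the closed formula, being positive,
    -- already yields integrability.
    refine Integrable.of_integral_ne_zero ?_
    rw [hv]
    positivity
  · rw [integral_gammaMeasure ha hr]
    simp_rw [e]
    rw [hv, Real.rpow_neg (by rw [sub_nonneg, div_le_one hr]; exact hb.le),
      show 1 - b / r = (r - b) / r by field_simp, Real.div_rpow hrb.le hr.le,
      Real.div_rpow zero_le_one hrb.le, Real.one_rpow]
    have := (Real.rpow_pos_of_pos hrb a).ne'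
    field_simp

theorem exp_moment_gaussianReal (c : ℝ) :
    Integrable (fun z => Real.exp (c * z)) (gaussianReal 0 1) ∧
      ∫ z, Real.exp (c * z) ∂gaussianReal 0 1 = Real.exp (c ^ 2 / 2) := by
  refine ⟨integrable_exp_mul_gaussianReal c, ?_⟩
  have := congrFun (mgf_id_gaussianReal (μ := 0) (v := 1)) c
  simpa [mgf] using this

/-- Given the time `y`, the Gaussian moment is `exp (c² σ² y / 2)`. Its Gamma average is finite when
`c² σ² / 2 < 1 / ν`, which is `|c| σ_ν < 1` squared. -/
theorem exp_moment_vgLaw {σ ν t c : ℝ} (hσ : 0 < σ) (hν : 0 < ν) (ht : 0 < t)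
    (hc : |c| * rescaledVol σ ν < 1) :
    Integrable (fun x => Real.exp (c * x)) (vgLaw σ ν t) ∧
      ∫ x, Real.exp (c * x) ∂vgLaw σ ν t = (1 - c ^ 2 * rescaledVol σ ν ^ 2) ^ (-(t / ν)) := by
  have ha : 0 < t / ν := by positivity
  have hr : 0 < 1 / ν := by positivity
  have := isProbabilityMeasure_gammaMeasure ha hr
  have hs := rescaledVol_pos hσ hν
  have hm : Measurable fun p : ℝ × ℝ => σ * (√p.1 * p.2) := by fun_prop
  have hme : Measurable fun x => Real.exp (c * x) := by fun_prop
  have hb : c ^ 2 * σ ^ 2 / 2 < 1 / ν := by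
    have h1 : (|c| * rescaledVol σ ν) ^ 2 < 1 := by
      rw [sq_lt_one_iff_abs_lt_one, abs_of_nonneg (by positivity)]; exact hc
    rw [mul_pow, sq_abs, rescaledVol_sq σ hν] at h1
    rw [lt_div_iff₀ hν]; linarith
  obtain ⟨hgi, hgv⟩ := exp_moment_gammaMeasure ha hr hb
  have e : ∀ y z : ℝ, c * (σ * (√y * z)) = (c * σ * √y) * z := fun y z => by ring
  have hinner : ∀ᵐ y ∂gammaMeasure (t / ν) (1 / ν),
      ∫ z, Real.exp (c * (σ * (√y * z))) ∂gaussianReal 0 1 = Real.exp (c ^ 2 * σ ^ 2 / 2 * y) := by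
    filter_upwards [ae_gammaMeasure_pos _ _] with y hy
    simp_rw [e]
    rw [(exp_moment_gaussianReal _).2]
    congr 1
    rw [mul_pow, mul_pow, Real.sq_sqrt hy.le]; ring
  have hprod : Integrable (fun p : ℝ × ℝ => Real.exp (c * (σ * (√p.1 * p.2))))
      ((gammaMeasure (t / ν) (1 / ν)).prod (gaussianReal 0 1)) := by
    rw [integrable_prod_iff (by fun_prop)]
    refine ⟨ae_of_all _ fun y => ?_, ?_⟩
    · simp_rw [e]
      exact (exp_moment_gaussianReal _).1
    · simp_rw [Real.norm_of_nonneg (Real.exp_pos _).le]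
      exact hgi.congr (hinner.mono fun y hy => hy.symm)
  constructor
  · rw [vgLaw, integrable_map_measure hme.aestronglyMeasurable hm.aemeasurable]
    exact hprod
  · rw [vgLaw, integral_map hm.aemeasurable hme.aestronglyMeasurable, integral_prod _ hprod,
      integral_congr_ae hinner, hgv, rescaledVol_sq σ hν]
    congr 2
    field_simp

theorem setIntegral_pow_gaussianReal (n : ℕ) :
    ∫ z in Set.Ioi 0, z ^ n ∂gaussianReal 0 1 =
      2 ^ ((n : ℝ) / 2) * Real.Gamma ((n + 1) / 2) / (2 * √Real.pi) := by
  rw [gaussianReal_of_var_ne_zero _ one_ne_zero,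
    setIntegral_withDensity_eq_setIntegral_toReal_smul (measurable_gaussianPDF _ _)
      (ae_of_all _ fun _ => gaussianPDF_lt_top) _ measurableSet_Ioi]
  have e : ∀ z ∈ Set.Ioi (0 : ℝ), (gaussianPDF 0 1 z).toReal • z ^ n =
      (√(2 * Real.pi))⁻¹ * (z ^ (n : ℝ) * Real.exp (-(1 / 2) * z ^ (2 : ℝ))) := fun z _ => by
    rw [toReal_gaussianPDF, gaussianPDFReal, Real.rpow_natCast, Real.rpow_two, smul_eq_mul]
    simp only [NNReal.coe_one, mul_one, sub_zero]
    rw [show -z ^ 2 / 2 = -(1 / 2) * z ^ 2 by ring]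
    ring
  rw [setIntegral_congr_fun measurableSet_Ioi e, integral_const_mul,
    integral_rpow_mul_exp_neg_mul_rpow two_pos (by have : (0 : ℝ) ≤ n := by positivity
                                                   linarith) (by norm_num),
    Real.sqrt_mul zero_le_two, one_div, Real.inv_rpow zero_le_two, ← Real.rpow_neg zero_le_two,
    show -(-((n : ℝ) + 1) / 2) = n / 2 + 1 / 2 by ring, Real.rpow_add two_pos,
    ← Real.sqrt_eq_rpow]
  have : √(2 : ℝ) ≠ 0 := by positivity
  field_simp

theorem integral_sqrt_pow_gammaMeasure {a ν : ℝ} (ha : 0 < a) (hν : 0 < ν) (n : ℕ) :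
    ∫ y, √y ^ n ∂gammaMeasure a (1 / ν) =
      ν ^ ((n : ℝ) / 2) * Real.Gamma (a + n / 2) / Real.Gamma a := by
  have e : ∀ y ∈ Set.Ioi (0 : ℝ), y ^ (a - 1) * Real.exp (-(1 / ν * y)) * √y ^ n =
      y ^ (a + n / 2 - 1) * Real.exp (-(1 / ν * y)) := fun y hy => by
    have hy0 : 0 < y := hy
    rw [Real.sqrt_eq_rpow, ← Real.rpow_natCast, ← Real.rpow_mul hy0.le, mul_right_comm,
      ← Real.rpow_add hy0]
    congr 2; ring
  rw [integral_gammaMeasure ha (by positivity), setIntegral_congr_fun measurableSet_Ioi e,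
    Real.integral_rpow_mul_exp_neg_mul_Ioi (by positivity) (by positivity), one_div_one_div,
    Real.rpow_add hν, one_div, Real.inv_rpow hν.le]
  have := (Real.rpow_pos_of_pos hν a).ne'
  field_simp

/-- The sign of `σ √y z` is that of `z` for almost every `y`, so the half-line moment factors into a
Gamma moment and a Gaussian half-line moment. -/
theorem setIntegral_pow_vgLaw {σ ν t : ℝ} (hσ : 0 < σ) (hν : 0 < ν) (ht : 0 < t) (n : ℕ) :
    ∫ x in Set.Ioi 0, x ^ n ∂vgLaw σ ν t = n.factorial * rescaledVol σ ν ^ n *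
      Real.Gamma (t / ν + n / 2) / (2 * Real.Gamma (t / ν) * Real.Gamma (n / 2 + 1)) := by
  have ha : 0 < t / ν := by positivity
  have hm : Measurable fun p : ℝ × ℝ => σ * (√p.1 * p.2) := by fun_prop
  have := isProbabilityMeasure_gammaMeasure ha (show 0 < 1 / ν by positivity)
  have hpow : Measurable fun x : ℝ => x ^ n := by fun_prop
  have e : (fun p : ℝ × ℝ => (Set.Ioi (0 : ℝ)).indicator (fun x => x ^ n) (σ * (√p.1 * p.2)))
      =ᵐ[(gammaMeasure (t / ν) (1 / ν)).prod (gaussianReal 0 1)]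
      fun p => (σ ^ n * √p.1 ^ n) * (Set.Ioi (0 : ℝ)).indicator (fun z => z ^ n) p.2 := by
    have hp : ∀ᵐ p ∂(gammaMeasure (t / ν) (1 / ν)).prod (gaussianReal 0 1), 0 < p.1 :=
      Measure.quasiMeasurePreserving_fst.ae (ae_gammaMeasure_pos _ _)
    filter_upwards [hp] with p hp
    have hc : 0 < σ * √p.1 := mul_pos hσ (Real.sqrt_pos.2 hp)
    by_cases hz : 0 < p.2
    · rw [Set.indicator_of_mem (by rw [← mul_assoc]; exact mul_pos hc hz),
        Set.indicator_of_mem (by exact hz)]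
      ring
    · rw [Set.indicator_of_notMem, Set.indicator_of_notMem (by exact hz), mul_zero]
      rw [Set.mem_Ioi, ← mul_assoc, mul_pos_iff_of_pos_left hc]
      exact hz
  rw [← integral_indicator measurableSet_Ioi, vgLaw, integral_map hm.aemeasurable
    (hpow.indicator measurableSet_Ioi).aestronglyMeasurable, integral_congr_ae e,
    integral_prod_mul (fun y => σ ^ n * √y ^ n) (fun z => (Set.Ioi (0 : ℝ)).indicator
      (fun z => z ^ n) z), integral_indicator measurableSet_Ioi, setIntegral_pow_gaussianReal,
    integral_const_mul, integral_sqrt_pow_gammaMeasure ha hν]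
  -- Duplication turns the Gaussian factor `Γ((n + 1) / 2)` into `n! / Γ(n / 2 + 1)`; this `n!` will
  -- cancel the one of the exponential series.
  have dup := Real.Gamma_mul_Gamma_add_half (((n : ℝ) + 1) / 2)
  rw [show ((n : ℝ) + 1) / 2 + 1 / 2 = n / 2 + 1 by ring,
    mul_div_cancel₀ _ (two_ne_zero' ℝ), Real.Gamma_nat_eq_factorial,
    show 1 - ((n : ℝ) + 1) = -n by ring, Real.rpow_neg zero_le_two, Real.rpow_natCast] at dup
  have hG2 : Real.Gamma ((n : ℝ) / 2 + 1) ≠ 0 := (Real.Gamma_pos_of_pos (by positivity)).ne'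
  have hG1 := (Real.Gamma_pos_of_pos ha).ne'
  have hs : rescaledVol σ ν ^ n = σ ^ n * ν ^ ((n : ℝ) / 2) * 2 ^ ((n : ℝ) / 2) / 2 ^ n := by
    rw [rescaledVol, mul_pow, Real.sqrt_eq_rpow, ← Real.rpow_natCast (( _ : ℝ) ^ _),
      ← Real.rpow_mul (by positivity), Real.div_rpow hν.le zero_le_two,
      show 1 / 2 * (n : ℝ) = n / 2 by ring]
    have h2 : (2 : ℝ) ^ n = 2 ^ ((n : ℝ) / 2) * 2 ^ ((n : ℝ) / 2) := by
      rw [← Real.rpow_add two_pos, add_halves, Real.rpow_natCast]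
    have := (Real.rpow_pos_of_pos two_pos ((n : ℝ) / 2)).ne'
    rw [h2]
    field_simp
  have hpi : √Real.pi ≠ 0 := by positivity
  rw [hs, eq_div_of_mul_eq hG2 dup]
  field_simp

/-- Half-line exponential moment of the Variance Gamma law, expanded in the exponent. -/
theorem hasSum_setIntegral_exp_vgLaw {σ ν t c : ℝ} (hσ : 0 < σ) (hν : 0 < ν) (ht : 0 < t)
    (hc : |c| * rescaledVol σ ν < 1) :
    HasSum (fun n : ℕ => Real.Gamma (t / ν + n / 2) / Real.Gamma (n / 2 + 1) *
      (c * rescaledVol σ ν) ^ n / (2 * Real.Gamma (t / ν)))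
      (∫ x in Set.Ioi 0, Real.exp (c * x) ∂vgLaw σ ν t) := by
  have key := hasSum_integral_of_dominated_convergence (μ := (vgLaw σ ν t).restrict (Set.Ioi 0))
    (F := fun (n : ℕ) x => c ^ n / n.factorial * x ^ n) (f := fun x => Real.exp (c * x))
    (fun n x => (|c| * x) ^ n / n.factorial)
    (fun n => by fun_prop)
    (fun n => (ae_restrict_mem measurableSet_Ioi).mono fun x (hx : 0 < x) => by
      rw [Real.norm_eq_abs, abs_mul, abs_div, abs_pow, abs_pow, Nat.abs_cast, abs_of_pos hx,
        mul_pow]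
      exact le_of_eq (by ring))
    (ae_of_all _ fun x => Real.summable_pow_div_factorial _)
    (by
      -- The majorants add up to `exp (|c| x)`, whose integrability is where `|c| σ_ν < 1` enters.
      simp_rw [(hasSum_exp _).tsum_eq]
      exact (exp_moment_vgLaw hσ hν ht (by rwa [abs_abs])).1.integrableOn)
    (ae_of_all _ fun x => (hasSum_exp _).congr_fun fun n => by rw [mul_pow]; ring)
  refine key.congr_fun fun n => ?_
  rw [integral_const_mul, setIntegral_pow_vgLaw hσ hν ht]
  rw [mul_pow]
  field_simp


/-! ### Termwise integration over `(0, κ]` by Beta integrals. -/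

theorem integrable_of_hasSum_of_le_mul {ι X : Type*} [Countable ι] [MeasurableSpace X]
    {μ : Measure X} {F : ι → X → ℝ} {f g : X → ℝ} {b : ι → ℝ}
    (hF : ∀ i, AEStronglyMeasurable (F i) μ) (hg : Integrable g μ) (hb : Summable b)
    (hle : ∀ᵐ x ∂μ, ∀ i, |F i x| ≤ b i * g x) (hf : ∀ᵐ x ∂μ, HasSum (fun i => F i x) (f x)) :
    Integrable f μ := by
  have hm : AEStronglyMeasurable f μ :=
    aestronglyMeasurable_of_tendsto_ae (u := (atTop : Filter (Finset ι)))
      (f := fun s x => ∑ i ∈ s, F i x)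
      (fun s => Finset.aestronglyMeasurable_fun_sum s fun i _ => hF i) (hf.mono fun x hx => hx)
  refine (hg.const_mul (∑' i, b i)).mono' hm ?_
  filter_upwards [hle, hf] with x h1 h2
  rw [← h2.tsum_eq, ← tsum_mul_right]
  exact tsum_of_norm_bounded (hb.mul_right (g x)).hasSum h1

theorem intervalIntegrable_sub_pow_mul_rpow {β : ℝ} (hβ : -1 < β) (κ : ℝ) (n : ℕ) :
    IntervalIntegrable (fun x => (κ - x) ^ n * x ^ β) volume 0 κ :=
  (intervalIntegral.intervalIntegrable_rpow' hβ).continuousOn_mul (by fun_prop)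

/-- A Beta integral, by induction on `n`: splitting one factor `κ - x` gives two integrals of degree
`n`, with exponents `β` and `β + 1`. -/
theorem integral_sub_pow_mul_rpow {β κ : ℝ} (hβ : -1 < β) (hκ : 0 < κ) (n : ℕ) :
    ∫ x in (0 : ℝ)..κ, (κ - x) ^ n * x ^ β =
      κ ^ (n + β + 1) * n.factorial * Real.Gamma (β + 1) / Real.Gamma (n + β + 2) := by
  induction n generalizing β with
  | zero =>
    have hG := (Real.Gamma_pos_of_pos (show 0 < β + 1 by linarith)).ne'
    have h1 : β + 1 ≠ 0 := by linarith
    simp only [pow_zero, one_mul, Nat.cast_zero, zero_add, Nat.factorial_zero, Nat.cast_one, mul_one]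
    rw [integral_rpow (Or.inl hβ), Real.zero_rpow h1, sub_zero,
      show β + 2 = β + 1 + 1 by ring, Real.Gamma_add_one h1]
    field_simp
  | succ n ih =>
    have hn : (0 : ℝ) ≤ n := by positivity
    have e : ∀ x ∈ Set.uIcc 0 κ, (κ - x) ^ (n + 1) * x ^ β =
        κ * ((κ - x) ^ n * x ^ β) - (κ - x) ^ n * x ^ (β + 1) := fun x hx => by
      rw [Set.uIcc_of_le hκ.le] at hx
      rcases hx.1.eq_or_lt with rfl | h
      · rw [Real.zero_rpow (show β + 1 ≠ 0 by linarith)]; ring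
      · rw [Real.rpow_add_one h.ne']; ring
    rw [intervalIntegral.integral_congr e, intervalIntegral.integral_sub
      ((intervalIntegrable_sub_pow_mul_rpow hβ κ n).const_mul κ)
      (intervalIntegrable_sub_pow_mul_rpow (by linarith) κ n),
      intervalIntegral.integral_const_mul, ih hβ, ih (by linarith)]
    have h1 : β + 1 ≠ 0 := by linarith
    have h2 : n + β + 2 ≠ 0 := by linarith
    have hG := (Real.Gamma_pos_of_pos (show 0 < n + β + 2 by linarith)).ne'
    rw [show (n : ℝ) + (β + 1) + 2 = n + β + 2 + 1 by ring, Real.Gamma_add_one h1,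
      Nat.factorial_succ]
    push_cast
    rw [show (n : ℝ) + 1 + β + 2 = n + β + 2 + 1 by ring, Real.Gamma_add_one h2,
      show (n : ℝ) + (β + 1) + 1 = n + β + 1 + 1 by ring,
      show (n : ℝ) + 1 + β + 1 = n + β + 1 + 1 by ring,
      Real.rpow_add_one hκ.ne' ((n : ℝ) + β + 1)]
    field_simp
    ring

/-- Termwise integration of `e^{-p (κ - x)} x^β ∑ d_j x^{2 j}` over `(0, κ]`. -/
theorem hasSum_integral_exp_mul_rpow_mul {β κ p : ℝ} (hβ : -1 < β) (hκ : 0 < κ) {d : ℕ → ℝ}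
    (hd : Summable fun j => |d j| * κ ^ (2 * j)) {φ : ℝ → ℝ}
    (hφ : ∀ x ∈ Set.Ioc 0 κ, HasSum (fun j => d j * x ^ (2 * j)) (φ x)) :
    IntegrableOn (fun x => Real.exp (-p * (κ - x)) * (x ^ β * φ x)) (Set.Ioc 0 κ) ∧
    HasSum (fun m : ℕ × ℕ => (-p) ^ m.2 * d m.1 * (κ ^ (m.2 + (β + 2 * m.1) + 1) *
      Real.Gamma (β + 2 * m.1 + 1) / Real.Gamma (m.2 + (β + 2 * m.1) + 2)))
      (∫ x in Set.Ioc 0 κ, Real.exp (-p * (κ - x)) * (x ^ β * φ x)) := by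
  -- The exponential is expanded in powers of `κ - x`, not of `x`, so that every term is a single
  -- Beta integral, whatever the size of `p`.
  let F : ℕ × ℕ → ℝ → ℝ := fun m x =>
    (-p) ^ m.2 * d m.1 / m.2.factorial * ((κ - x) ^ m.2 * x ^ (β + 2 * m.1))
  have hF : ∀ m, AEStronglyMeasurable (F m) (volume.restrict (Set.Ioc 0 κ)) := fun m =>
    Measurable.aestronglyMeasurable (by fun_prop)
  have hg : IntegrableOn (fun x : ℝ => x ^ β) (Set.Ioc 0 κ) :=
    (intervalIntegral.intervalIntegrable_rpow' hβ).1
  have hb : Summable fun m : ℕ × ℕ => |d m.1| * κ ^ (2 * m.1) * ((|p| * κ) ^ m.2 / m.2.factorial) :=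
    hd.mul_of_nonneg (Real.summable_pow_div_factorial _) (fun _ => by positivity)
      (fun _ => by positivity)
  have hle : ∀ᵐ x ∂volume.restrict (Set.Ioc 0 κ), ∀ m, |F m x| ≤
      |d m.1| * κ ^ (2 * m.1) * ((|p| * κ) ^ m.2 / m.2.factorial) * x ^ β := by
    filter_upwards [ae_restrict_mem measurableSet_Ioc] with x hx m
    have h0 : 0 ≤ κ - x := by linarith [hx.2]
    have h1 : (κ - x) ^ m.2 ≤ κ ^ m.2 := pow_le_pow_left₀ h0 (by linarith [hx.1]) _
    have h2 : x ^ (2 * m.1) ≤ κ ^ (2 * m.1) := pow_le_pow_left₀ hx.1.le hx.2 _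
    have h3 : x ^ (β + 2 * m.1) = x ^ β * x ^ (2 * m.1) := by
      rw [Real.rpow_add hx.1, ← Real.rpow_natCast]; push_cast; rfl
    have h4 : 0 ≤ x ^ β * x ^ (2 * m.1) :=
      mul_nonneg (Real.rpow_nonneg hx.1.le β) (pow_nonneg hx.1.le _)
    have h5 := Real.rpow_nonneg hx.1.le β
    simp only [F]
    rw [h3, abs_mul, abs_div, abs_mul, abs_pow, abs_neg, Nat.abs_cast, abs_of_nonneg
      (mul_nonneg (pow_nonneg h0 _) h4), mul_pow]
    calc |p| ^ m.2 * |d m.1| / m.2.factorial * ((κ - x) ^ m.2 * (x ^ β * x ^ (2 * m.1)))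
        ≤ |p| ^ m.2 * |d m.1| / m.2.factorial * (κ ^ m.2 * (x ^ β * κ ^ (2 * m.1))) := by gcongr
      _ = _ := by ring
  have hf : ∀ᵐ x ∂volume.restrict (Set.Ioc 0 κ),
      HasSum (fun m => F m x) (Real.exp (-p * (κ - x)) * (x ^ β * φ x)) := by
    filter_upwards [ae_restrict_mem measurableSet_Ioc, hle] with x hx hx'
    have hs : Summable fun m => F m x :=
      Summable.of_norm_bounded (hb.mul_right (x ^ β)) fun m => hx' m
    have hprod := ((hφ x hx).mul_left (x ^ β)).mul (hasSum_exp (-p * (κ - x)))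
      (hs.congr fun m => by
        simp only [F]
        rw [Real.rpow_add hx.1, mul_pow, ← Real.rpow_natCast x]
        push_cast; ring)
    rw [mul_comm (Real.exp _)]
    refine hprod.congr_fun fun m => ?_
    simp only [F]
    rw [Real.rpow_add hx.1, mul_pow, ← Real.rpow_natCast x]
    push_cast; ring
  refine ⟨integrable_of_hasSum_of_le_mul hF hg hb hle hf,
    (hasSum_integral_of_le_mul hF hg hb hle hf).congr_fun fun m => ?_⟩
  have hm : (0 : ℝ) ≤ m.1 := by positivity
  simp only [F]
  rw [integral_const_mul, ← intervalIntegral.integral_of_le hκ.le,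
    integral_sub_pow_mul_rpow (by linarith) hκ]
  have := m.2.factorial_ne_zero
  field_simp


/-! ### Assembly of the double series. -/

theorem summable_abs_Gamma_sub_nat {x : ℝ} (hx : ∀ m : ℤ, x ≠ m) (C z κ : ℝ) (hz : 0 < z)
    (hκ : 0 ≤ κ) :
    Summable fun j : ℕ =>
      |C * ((-1) ^ j / j.factorial) * Real.Gamma (x - j) / z ^ j| * κ ^ (2 * j) := by
  obtain ⟨B, hB0, hB⟩ := exists_abs_Gamma_sub_nat_le hx
  refine Summable.of_nonneg_of_le (fun j => by positivity) (fun j => ?_)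
    ((Real.summable_pow_div_factorial (κ ^ 2 / z)).mul_left (|C| * B))
  rw [abs_div, abs_mul, abs_mul, abs_div, abs_pow, abs_neg, abs_one, one_pow, Nat.abs_cast,
    abs_of_pos (pow_pos hz j)]
  calc |C| * (1 / j.factorial) * |Real.Gamma (x - j)| / z ^ j * κ ^ (2 * j)
      ≤ |C| * (1 / j.factorial) * B / z ^ j * κ ^ (2 * j) := by
        have := hB j
        gcongr
    _ = _ := by rw [div_pow, pow_mul]; ring

/-- The part of the double series carrying `coeffA`, normalised to a positive moneyness `κ`. -/
noncomputable def powerTermA (α p κ s : ℝ) (n : ℕ × ℕ) : ℝ :=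
  (-1) ^ n.1 / (n.1.factorial : ℝ) * p ^ n.2 * (coeffA α n * (κ / s) ^ n.1 * s ^ n.2)

/-- The part of the double series carrying `coeffB`, normalised to a positive moneyness `κ`. -/
noncomputable def powerTermB (α p κ s : ℝ) (n : ℕ × ℕ) : ℝ :=
  (-1) ^ n.1 / (n.1.factorial : ℝ) * p ^ n.2 *
    (2 * coeffB α n * (κ / s) ^ (2 * (n.1 : ℝ) + 1 + 2 * α) * κ ^ n.2)

/-- Independence of `n` makes this half of the double series a product of two simple series. -/
theorem coeffA_lower (α : ℝ) (n m : ℕ) :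
    coeffA α (n, n + m) = Real.Gamma (α + 1 / 2 + m / 2) / Real.Gamma (m / 2 + 1) := by
  unfold coeffA
  push_cast
  congr 2 <;> ring

theorem coeffA_upper_odd (α : ℝ) (j n : ℕ) :
    coeffA α (n + (2 * j + 1), n) = Real.Gamma (α - j) *
      ((2 * j).factorial * (-1) ^ j / (j.factorial * 4 ^ j * √Real.pi)) := by
  rw [← Gamma_half_sub_nat_inv, ← div_eq_mul_inv]
  unfold coeffA
  push_cast
  congr 2 <;> ring

/-- The denominator sits at the pole `-j`, where `Real.Gamma` is `0`, and division by `0` gives `0`.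
-/
theorem coeffA_upper_even (α : ℝ) (j n : ℕ) : coeffA α (n + (2 * j + 2), n) = 0 := by
  unfold coeffA
  push_cast
  rw [show (-((n : ℝ) + (2 * j + 2)) + n) / 2 + 1 = -j by ring, Real.Gamma_neg_nat_eq_zero, div_zero]

/-- Reindexing of a double series over the part on or above the diagonal and the part below it,
where only odd differences contribute. -/
theorem hasSum_of_diagonal_split {T : ℕ × ℕ → ℝ} {x y : ℝ}
    (h1 : HasSum (fun m : ℕ × ℕ => T (m.1, m.1 + m.2)) x)
    (h2 : HasSum (fun m : ℕ × ℕ => T (m.2 + (2 * m.1 + 1), m.2)) y)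
    (h0 : ∀ j n, T (n + (2 * j + 2), n) = 0) : HasSum T (x + y) := by
  let e1 : ℕ × ℕ → ℕ × ℕ := fun m => (m.1, m.1 + m.2)
  let e2 : ℕ × ℕ → ℕ × ℕ := fun m => (m.2 + (2 * m.1 + 1), m.2)
  have i1 : Function.Injective e1 := fun a b h => by
    simp only [e1, Prod.mk.injEq] at h
    ext <;> omega
  have i2 : Function.Injective e2 := fun a b h => by
    simp only [e2, Prod.mk.injEq] at h
    ext <;> omega
  let S : Set (ℕ × ℕ) := {n | n.1 ≤ n.2}
  have k1 : HasSum (S.indicator T) x := by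
    rw [← i1.hasSum_iff]
    · refine h1.congr_fun fun m => ?_
      simp [S, e1]
    · intro n hn
      refine Set.indicator_of_notMem (fun h => hn ⟨(n.1, n.2 - n.1), ?_⟩) _
      have : n.1 ≤ n.2 := h
      simp only [e1]; ext <;> simp; omega
  have k2 : HasSum (Sᶜ.indicator T) y := by
    rw [← i2.hasSum_iff]
    · refine h2.congr_fun fun m => ?_
      simp [S, e2]
    · intro n hn
      by_cases h : n ∈ Sᶜ
      · rw [Set.indicator_of_mem h]
        have hlt : n.2 < n.1 := by simpa [S] using h
        obtain ⟨c, hc⟩ := Nat.exists_eq_add_of_lt hlt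
        rcases Nat.even_or_odd' c with ⟨j, rfl | rfl⟩
        · exact absurd ⟨(j, n.2), by simp only [e2]; ext <;> simp; omega⟩ hn
        · have : n = (n.2 + (2 * j + 2), n.2) := by ext <;> simp; omega
          rw [this, h0]
      · exact Set.indicator_of_notMem h _
  have := k1.add k2
  rwa [show (fun b => S.indicator T b + Sᶜ.indicator T b) = T from
    funext fun b => congrFun (Set.indicator_self_add_compl S T) b] at this

theorem setIntegral_vgLaw {σ ν t : ℝ} (hσ : 0 < σ) (hν : 0 < ν) (ht : 0 < t) {S : Set ℝ}
    (hS : MeasurableSet S) (g : ℝ → ℝ) :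
    ∫ x in S, g x ∂vgLaw σ ν t = ∫ x in S, vgDensity σ ν (t / ν) x * g x := by
  have ha : 0 < t / ν := by positivity
  rw [vgLaw_eq_withDensity hσ hν ht, setIntegral_withDensity_eq_setIntegral_toReal_smul
    (measurable_vgDensity _ _ _).ennreal_ofReal (ae_of_all _ fun _ => ENNReal.ofReal_lt_top) _ hS]
  simp_rw [ENNReal.toReal_ofReal (vgDensity_nonneg hσ hν ha _), smul_eq_mul]

/-- The partial exponential moment of the Variance Gamma law over `(0, κ]` as a sum of two double
series, one for each half of the expansion of the density. -/
theorem exists_hasSum_setIntegral_Ioc_vgLaw {σ ν t p κ : ℝ} (hσ : 0 < σ) (hν : 0 < ν) (ht : 0 < t)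
    (hα : ∀ m : ℤ, t / ν - 1 / 2 ≠ m) (hκ : 0 < κ) :
    ∃ A B : ℝ, ∫ x in Set.Ioc 0 κ, Real.exp (p * (x - κ)) ∂vgLaw σ ν t = A + B ∧
      HasSum (fun m : ℕ × ℕ => powerTermA (t / ν - 1 / 2) p κ (rescaledVol σ ν)
        (m.2 + (2 * m.1 + 1), m.2)) (-(2 * Real.Gamma (t / ν)) * A) ∧
      HasSum (powerTermB (t / ν - 1 / 2) p κ (rescaledVol σ ν))
        (-(2 * Real.Gamma (t / ν)) * B) := by
  set α := t / ν - 1 / 2 with hαdef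
  set s := rescaledVol σ ν with hs_def
  have hs : 0 < s := rescaledVol_pos hσ hν
  have ha : 0 < t / ν := by positivity
  have hG := Real.Gamma_pos_of_pos ha
  have hα' : -(1 / 2) < α := by linarith
  have hαn : ∀ m : ℤ, -α ≠ m := fun m hm => hα (-m) (by push_cast; linarith)
  set c := (2 * s * √Real.pi * Real.Gamma (t / ν))⁻¹ with hc
  -- Coefficients of `x ^ (2 j)` in the two halves of the density, with `w = x² / (4 s²)`; the
  -- second half carries the extra factor `x ^ (2 α)`, integrable at `0` because `α > -1 / 2`.
  let dA : ℕ → ℝ := fun j => c * ((-1) ^ j / j.factorial) * Real.Gamma (α - j) / (4 * s ^ 2) ^ j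
  let dB : ℕ → ℝ := fun j => c / (4 * s ^ 2) ^ α * ((-1) ^ j / j.factorial) *
    Real.Gamma (-α - j) / (4 * s ^ 2) ^ j
  have h4s : 0 < 4 * s ^ 2 := by positivity
  have hdA : ∀ z, 0 ≤ z → Summable fun j => |dA j| * z ^ (2 * j) := fun z hz =>
    summable_abs_Gamma_sub_nat hα c _ z h4s hz
  have hdB : ∀ z, 0 ≤ z → Summable fun j => |dB j| * z ^ (2 * j) := fun z hz =>
    summable_abs_Gamma_sub_nat hαn _ _ z h4s hz
  have hsA : ∀ x ∈ Set.Ioc 0 κ, HasSum (fun j => dA j * x ^ (2 * j)) (∑' j, dA j * x ^ (2 * j)) :=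
    fun x hx => (Summable.of_norm_bounded (hdA x hx.1.le) fun j => le_of_eq (by
      rw [Real.norm_eq_abs, abs_mul, abs_of_nonneg (pow_nonneg hx.1.le _)])).hasSum
  have hsB : ∀ x ∈ Set.Ioc 0 κ, HasSum (fun j => dB j * x ^ (2 * j)) (∑' j, dB j * x ^ (2 * j)) :=
    fun x hx => (Summable.of_norm_bounded (hdB x hx.1.le) fun j => le_of_eq (by
      rw [Real.norm_eq_abs, abs_mul, abs_of_nonneg (pow_nonneg hx.1.le _)])).hasSum
  obtain ⟨iA, kA⟩ := hasSum_integral_exp_mul_rpow_mul (p := p) (β := 0) (by norm_num) hκ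
    (hdA κ hκ.le) hsA
  obtain ⟨iB, kB⟩ := hasSum_integral_exp_mul_rpow_mul (p := p) (β := 2 * α) (by linarith) hκ
    (hdB κ hκ.le) hsB
  have hdens : ∀ x ∈ Set.Ioc 0 κ, vgDensity σ ν (t / ν) x =
      x ^ (0 : ℝ) * (∑' j, dA j * x ^ (2 * j)) + x ^ (2 * α) * ∑' j, dB j * x ^ (2 * j) := by
    intro x hx
    have hx0 := hx.1
    have hw : 0 < x ^ 2 / (4 * s ^ 2) := by positivity
    have h1 := (hasSum_besselIntegrand hα hw).mul_left c
    have h2 := ((hsA x hx).mul_left (x ^ (0 : ℝ))).add ((hsB x hx).mul_left (x ^ (2 * α)))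
    rw [vgDensity, div_eq_inv_mul, ← hs_def, ← hc, ← hαdef]
    refine h1.unique (h2.congr_fun fun j => ?_)
    simp only [dA, dB]
    rw [Real.rpow_zero, Real.rpow_add hw, Real.rpow_natCast, div_pow, Real.div_rpow (by positivity)
      (by positivity), ← pow_mul, ← Real.rpow_natCast x 2, ← Real.rpow_mul hx0.le]
    push_cast
    ring
  refine ⟨∫ x in Set.Ioc 0 κ, Real.exp (-p * (κ - x)) * (x ^ (0 : ℝ) * ∑' j, dA j * x ^ (2 * j)),
    ∫ x in Set.Ioc 0 κ, Real.exp (-p * (κ - x)) * (x ^ (2 * α) * ∑' j, dB j * x ^ (2 * j)),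
    ?_, ?_, ?_⟩
  rotate_left
  · refine (kA.mul_left (-(2 * Real.Gamma (t / ν)))).congr_fun fun m => ?_
    simp only [powerTermA, dA]
    rw [coeffA_upper_odd, show (0 : ℝ) + 2 * (m.1 : ℝ) + 1 = (2 * m.1 : ℕ) + 1 by push_cast; ring,
      Real.Gamma_nat_eq_factorial,
      show (m.2 : ℝ) + (0 + 2 * m.1) + 2 = (m.2 + (2 * m.1 + 1) : ℕ) + 1 by push_cast; ring,
      Real.Gamma_nat_eq_factorial,
      show (m.2 : ℝ) + (0 + 2 * m.1) + 1 = (m.2 + (2 * m.1 + 1) : ℕ) by push_cast; ring,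
      Real.rpow_natCast, hc, neg_pow p, div_pow, mul_pow, ← pow_mul,
      show (-1 : ℝ) ^ (m.2 + (2 * m.1 + 1)) = -(-1) ^ m.2 by rw [pow_add, pow_succ, pow_mul]; simp]
    have := m.1.factorial_ne_zero
    have := (m.2 + (2 * m.1 + 1)).factorial_ne_zero
    rw [show s ^ (m.2 + (2 * m.1 + 1)) = s ^ m.2 * s ^ (2 * m.1) * s by ring]
    field_simp
  · refine (kB.mul_left (-(2 * Real.Gamma (t / ν)))).congr_fun fun m => ?_
    have hm1 : (0 : ℝ) ≤ m.1 := by positivity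
    have hm2 : (0 : ℝ) ≤ m.2 := by positivity
    have hG2 := (Real.Gamma_pos_of_pos (show 0 < (m.2 : ℝ) + 2 * m.1 + 2 * α + 2 by linarith)).ne'
    simp only [powerTermB, dB]
    rw [coeffB_eq_coeffBReg hα' hα, coeffBReg,
      show 2 * α + 2 * (m.1 : ℝ) + 1 = 2 * m.1 + 2 * α + 1 by ring,
      show (m.2 : ℝ) + (2 * α + 2 * m.1) + 2 = m.2 + 2 * m.1 + 2 * α + 2 by ring, hc, neg_pow p,
      show (m.2 : ℝ) + (2 * α + 2 * m.1) + 1 = (2 * m.1 + 1 + 2 * α) + m.2 by ring,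
      Real.rpow_add hκ, Real.rpow_natCast κ, Real.div_rpow hκ.le hs.le,
      show -2 * α - 2 * (m.1 : ℝ) - 1 = -(2 * m.1 + 1 + 2 * α) by ring,
      Real.rpow_neg zero_le_two]
    have h1 : (4 * s ^ 2) ^ α * (4 * s ^ 2) ^ m.1 * (2 * s) =
        2 ^ (2 * (m.1 : ℝ) + 1 + 2 * α) * s ^ (2 * (m.1 : ℝ) + 1 + 2 * α) := by
      rw [← Real.mul_rpow zero_le_two hs.le, ← Real.rpow_natCast (4 * s ^ 2),
        ← Real.rpow_add h4s, show 4 * s ^ 2 = (2 * s) ^ (2 : ℝ) by rw [Real.rpow_two]; ring,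
        ← Real.rpow_mul (by positivity), ← Real.rpow_add_one (by positivity)]
      congr 1; ring
    have hp1 := (Real.rpow_pos_of_pos h4s α).ne'
    have hp2 := (Real.rpow_pos_of_pos hs (2 * (m.1 : ℝ) + 1 + 2 * α)).ne'
    have hp3 := (Real.rpow_pos_of_pos two_pos (2 * (m.1 : ℝ) + 1 + 2 * α)).ne'
    have hp4 : √Real.pi ≠ 0 := by positivity
    have hp5 := m.1.factorial_ne_zero
    have hp6 := pow_ne_zero m.1 h4s.ne'
    generalize (4 * s ^ 2) ^ α = P at *
    generalize (4 * s ^ 2) ^ m.1 = R at *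
    generalize (2 : ℝ) ^ (2 * (m.1 : ℝ) + 1 + 2 * α) = U at *
    generalize s ^ (2 * (m.1 : ℝ) + 1 + 2 * α) = V at *
    have h2 : U = P * R * (2 * s) / V := by rw [h1]; field_simp
    rw [h2]
    field_simp
  · rw [setIntegral_vgLaw hσ hν ht measurableSet_Ioc, ← integral_add iA iB]
    refine setIntegral_congr_fun measurableSet_Ioc fun x hx => ?_
    rw [hdens x hx, show p * (x - κ) = -p * (κ - x) by ring]
    ring


/-- Exponential moment of the Variance Gamma law beyond a positive level, as a double series. -/
theorem hasSum_setIntegral_Ioi_vgLaw {σ ν t p κ : ℝ} (hσ : 0 < σ) (hν : 0 < ν) (ht : 0 < t)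
    (hα : ∀ m : ℤ, t / ν - 1 / 2 ≠ m) (hκ : 0 < κ) (hp : |p| * rescaledVol σ ν < 1) :
    HasSum (fun n => powerTermA (t / ν - 1 / 2) p κ (rescaledVol σ ν) n +
      powerTermB (t / ν - 1 / 2) p κ (rescaledVol σ ν) n)
      (2 * Real.Gamma (t / ν) * ∫ x in Set.Ioi κ, Real.exp (p * (x - κ)) ∂vgLaw σ ν t) := by
  have ha : 0 < t / ν := by positivity
  have hs := rescaledVol_pos hσ hν
  have hG := Real.Gamma_pos_of_pos ha
  obtain ⟨A, B, hAB, hA, hB⟩ := exists_hasSum_setIntegral_Ioc_vgLaw (p := p) hσ hν ht hα hκ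
  have e : ∀ x, Real.exp (p * (x - κ)) = Real.exp (-p * κ) * Real.exp (p * x) := fun x => by
    rw [← Real.exp_add]; ring_nf
  have hint : Integrable (fun x => Real.exp (p * (x - κ))) (vgLaw σ ν t) := by
    simp_rw [e]
    exact (exp_moment_vgLaw hσ hν ht hp).1.const_mul _
  have hsplit : ∫ x in Set.Ioi κ, Real.exp (p * (x - κ)) ∂vgLaw σ ν t =
      Real.exp (-p * κ) * (∫ x in Set.Ioi 0, Real.exp (p * x) ∂vgLaw σ ν t) - (A + B) := by
    rw [← hAB, ← integral_const_mul, eq_sub_iff_add_eq, add_comm]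
    simp_rw [← e]
    rw [← setIntegral_union (Set.Ioc_disjoint_Ioi le_rfl) measurableSet_Ioi hint.integrableOn
      hint.integrableOn, Set.Ioc_union_Ioi_eq_Ioi hκ.le]
  have hH := (hasSum_setIntegral_exp_vgLaw hσ hν ht hp).mul_left (2 * Real.Gamma (t / ν))
  have hdiag := (hasSum_exp (-p * κ)).mul hH
    (summable_mul_of_summable_norm (hasSum_exp (-p * κ)).summable.norm hH.summable.norm)
  -- The index `m.1` comes from `exp (-p κ)` and `m.2` from the half-line moment: `n₁ = m.1` and `n₂
  -- = m.1 + m.2`.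
  have hdiag' : HasSum (fun m : ℕ × ℕ => powerTermA (t / ν - 1 / 2) p κ (rescaledVol σ ν)
      (m.1, m.1 + m.2)) (Real.exp (-p * κ) *
        (2 * Real.Gamma (t / ν) * ∫ x in Set.Ioi 0, Real.exp (p * x) ∂vgLaw σ ν t)) := by
    refine hdiag.congr_fun fun m => ?_
    rw [powerTermA, coeffA_lower, sub_add_cancel, div_pow, pow_add, pow_add,
      mul_pow, mul_pow, neg_pow p]
    field_simp
  have hA' := hasSum_of_diagonal_split hdiag' hA fun j n => by
    rw [powerTermA, coeffA_upper_even]; ring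
  convert! hA'.add hB using 1
  rw [hsplit]
  ring

theorem powerTerm_neg_left (α q κ s : ℝ) (n : ℕ × ℕ) :
    powerTerm α q (-κ) s n = powerTermA α q κ s n + powerTermB α q κ s n := by
  simp only [powerTerm, powerTermA, powerTermB, neg_neg]
  ring

/-- The ratio `-k / s` is now `κ / s`, and the signs left in `(-s) ^ n₂` and `(-κ) ^ n₂` are common
to both summands, hence absorbed by replacing `q` with `-q`. -/
theorem powerTerm_neg_right (α q κ s : ℝ) (n : ℕ × ℕ) :
    powerTerm α q κ (-s) n = powerTermA α (-q) κ s n + powerTermB α (-q) κ s n := by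
  simp only [powerTerm, powerTermA, powerTermB, neg_div_neg_eq]
  rw [neg_pow s, neg_pow κ, neg_pow q]
  ring

theorem setIntegral_Iic_neg_vgLaw {σ ν t : ℝ} (hσ : 0 < σ) (hν : 0 < ν) (ht : 0 < t) (κ : ℝ)
    (g : ℝ → ℝ) :
    ∫ x in Set.Iic (-κ), g x ∂vgLaw σ ν t = ∫ x in Set.Ioi κ, g (-x) ∂vgLaw σ ν t := by
  rw [setIntegral_vgLaw hσ hν ht measurableSet_Iic, setIntegral_vgLaw hσ hν ht measurableSet_Ioi]
  have := integral_comp_neg_Iic (-κ) (fun x => vgDensity σ ν (t / ν) x * g (-x))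
  simpa [vgDensity_neg] using this

/-! ### Conditioning on `ℱ t` and reduction to the law of the increment. -/

/-- Freezing lemma: a function of an `m`-measurable variable and a variable independent of `m`
is conditioned on `m` by integrating out the independent variable. -/
theorem condExp_comp_of_indep {Ω : Type*} {m mΩ : MeasurableSpace Ω} {Q : Measure Ω}
    [IsProbabilityMeasure Q] (hm : m ≤ mΩ) {Y D : Ω → ℝ} (hY : Measurable[m] Y) (hD : Measurable D)
    (hind : Indep (MeasurableSpace.comap D inferInstance) m Q) {g : ℝ → ℝ → ℝ}
    (hg : Measurable (Function.uncurry g)) (hint : Integrable (fun w => g (Y w) (D w)) Q) :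
    condExp m Q (fun w => g (Y w) (D w)) =ᵐ[Q] fun w => ∫ x, g (Y w) x ∂Q.map D := by
  have hprob : IsProbabilityMeasure (Q.map D) := Measure.isProbabilityMeasure_map hD.aemeasurable
  have hindep : ∀ {E : Type} [MeasurableSpace E] {Z : Ω → E}, Measurable[m] Z →
      Q.map (fun w => (Z w, D w)) = (Q.map Z).prod (Q.map D) := fun {E _ Z} hZ =>
    (indepFun_iff_map_prod_eq_prod_map_map (hZ.mono hm le_rfl).aemeasurable hD.aemeasurable).1
      ((IndepFun_iff_Indep _ _ _).2 (indep_of_indep_of_le_left hind.symm hZ.comap_le))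
  have hY' : Measurable Y := hY.mono hm le_rfl
  have hh : StronglyMeasurable fun y => ∫ x, g y x ∂Q.map D :=
    hg.stronglyMeasurable.integral_prod_right'
  have hintY : Integrable (fun w => ∫ x, g (Y w) x ∂Q.map D) Q := by
    have h1 : Integrable (Function.uncurry g) ((Q.map Y).prod (Q.map D)) := by
      rw [← hindep hY, integrable_map_measure hg.aestronglyMeasurable (by fun_prop)]
      exact hint
    exact (integrable_map_measure hh.aestronglyMeasurable hY'.aemeasurable).1 h1.integral_prod_left
  refine (ae_eq_condExp_of_forall_setIntegral_eq hm hint (fun s _ _ => hintY.integrableOn)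
    (fun s hs _ => ?_) (hh.comp_measurable hY).aestronglyMeasurable).symm
  -- Adjoining the indicator of `s` keeps the pair `m`-measurable, hence independent of `D`, and
  -- turns the integral over `s` into one against a product measure, to which Fubini applies.
  let Z : Ω → ℝ × ℝ := fun w => (Y w, s.indicator (fun _ => 1) w)
  have hZ : Measurable[m] Z := hY.prodMk (measurable_const.indicator hs)
  have hZ' : Measurable Z := hZ.mono hm le_rfl
  let h : (ℝ × ℝ) × ℝ → ℝ := fun z => z.1.2 * g z.1.1 z.2
  have hhm : Measurable h := (measurable_snd.comp measurable_fst).mul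
    (hg.comp ((measurable_fst.comp measurable_fst).prodMk measurable_snd))
  have eq1 : ∀ w, h (Z w, D w) = s.indicator (fun w => g (Y w) (D w)) w := fun w => by
    by_cases hw : w ∈ s <;> simp [h, Z, hw]
  have hhint : Integrable h ((Q.map Z).prod (Q.map D)) := by
    rw [← hindep hZ, integrable_map_measure hhm.aestronglyMeasurable (by fun_prop)]
    exact (hint.indicator (hm s hs)).congr (ae_of_all _ fun w => (eq1 w).symm)
  calc ∫ w in s, ∫ x, g (Y w) x ∂Q.map D ∂Q
      = ∫ w, ∫ x, h (Z w, x) ∂Q.map D ∂Q := by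
        rw [← integral_indicator (hm s hs)]
        congr 1
        ext w
        by_cases hw : w ∈ s <;> simp [h, Z, hw]
    _ = ∫ z, ∫ x, h (z, x) ∂Q.map D ∂Q.map Z :=
        (integral_map hZ'.aemeasurable
          hhm.stronglyMeasurable.integral_prod_right'.aestronglyMeasurable).symm
    _ = ∫ z, h z ∂(Q.map Z).prod (Q.map D) := (integral_prod _ hhint).symm
    _ = ∫ w, h (Z w, D w) ∂Q := by
        rw [← hindep hZ, integral_map (by fun_prop) hhm.aestronglyMeasurable]
    _ = ∫ w in s, g (Y w) (D w) ∂Q := by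
        simp_rw [eq1]
        exact integral_indicator (hm s hs)


/-- This identity explains the definition of the moneyness: exercise means `x > -k`, and the spot
price enters only through `k`. -/
theorem rpow_eq_exp_powerMoneyness {S K q : ℝ} (hS : 0 < S) (hK : 0 < K) (hq : 0 < q)
    (r σ ν τ x : ℝ) :
    (S * Real.exp ((r + martAdj σ ν) * τ + x)) ^ q =
      K * Real.exp (q * (powerMoneyness S K r q σ ν τ + x)) := by
  have hKq : 0 < K ^ (1 / q) := by positivity
  rw [Real.rpow_def_of_pos (by positivity), Real.log_mul hS.ne' (Real.exp_pos _).ne', Real.log_exp,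
    powerMoneyness, Real.log_div hS.ne' hKq.ne', Real.log_rpow hK]
  nth_rewrite 1 [← Real.exp_log hK]
  rw [← Real.exp_add]
  congr 1
  field_simp
  ring

theorem powerPayoff_eq_exp {S K q : ℝ} (hS : 0 < S) (hK : 0 < K) (hq : 0 < q) (r σ ν τ x : ℝ) :
    powerPayoff q K (S * Real.exp ((r + martAdj σ ν) * τ + x)) =
      (Set.Ioi (-powerMoneyness S K r q σ ν τ)).indicator
        (fun x => K * Real.exp (q * (powerMoneyness S K r q σ ν τ + x))) x := by
  have hiff : K < K * Real.exp (q * (powerMoneyness S K r q σ ν τ + x)) ↔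
      x ∈ Set.Ioi (-powerMoneyness S K r q σ ν τ) := by
    rw [lt_mul_iff_one_lt_right hK, Real.one_lt_exp_iff, mul_pos_iff_of_pos_left hq, Set.mem_Ioi,
      neg_lt_iff_pos_add']
  rw [powerPayoff, rpow_eq_exp_powerMoneyness hS hK hq]
  by_cases h : x ∈ Set.Ioi (-powerMoneyness S K r q σ ν τ)
  · rw [if_pos (hiff.2 h), Set.indicator_of_mem h]
  · rw [if_neg (mt hiff.1 h), Set.indicator_of_notMem h]

theorem discountedMoment_eq_exp {S K q : ℝ} (hS : 0 < S) (hK : 0 < K) (hq : 0 < q)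
    (r σ ν τ : ℝ) :
    discountedMoment S r q σ ν τ = K * Real.exp (-r * τ) *
      (Real.exp (q * powerMoneyness S K r q σ ν τ) *
        (1 - q ^ 2 * rescaledVol σ ν ^ 2) ^ (-(τ / ν))) := by
  have h := rpow_eq_exp_powerMoneyness hS hK hq r σ ν τ 0
  rw [add_zero, add_zero, Real.mul_rpow hS.le (Real.exp_pos _).le, ← Real.exp_mul] at h
  rw [discountedMoment, ← mul_assoc]
  congr 1
  rw [mul_right_comm, ← h, mul_assoc, ← Real.exp_add]
  ring_nf

theorem stock_pos {Ω : Type*} {S₀ : ℝ} (hS : 0 < S₀) (r σ ν : ℝ) (X : ℝ≥0 → Ω → ℝ) (t : ℝ≥0)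
    (w : Ω) : 0 < stock S₀ r σ ν X t w := by
  unfold stock; positivity

theorem stock_eq_mul_exp {Ω : Type*} (S₀ r σ ν : ℝ) (X : ℝ≥0 → Ω → ℝ) (t T : ℝ≥0) (w : Ω) :
    stock S₀ r σ ν X T w = stock S₀ r σ ν X t w *
      Real.exp ((r + martAdj σ ν) * ((T : ℝ) - t) + (X T w - X t w)) := by
  unfold stock
  rw [mul_assoc, ← Real.exp_add]
  congr 2
  ring

theorem integrable_stock_rpow {Ω : Type*} [mΩ : MeasurableSpace Ω] {Q : Measure Ω}
    {ℱ : Filtration ℝ≥0 mΩ} {X : ℝ≥0 → Ω → ℝ} {S₀ q σ ν : ℝ} {T : ℝ≥0} (r : ℝ) (hS : 0 < S₀)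
    (hq : 0 < q) (hσ : 0 < σ) (hν : 0 < ν) (hT : 0 < T) (hX : IsVGProcess Q ℱ σ ν X)
    (hmom : q * rescaledVol σ ν < 1) :
    Integrable (fun w => stock S₀ r σ ν X T w ^ q) Q := by
  have hm : ∀ u, Measurable (X u) := fun u => (hX.adapted u).mono (ℱ.le u) le_rfl
  have hD : Measurable fun w => X T w - X 0 w := (hm T).sub (hm 0)
  have hexp := (exp_moment_vgLaw (t := (T : ℝ) - (0 : ℝ≥0)) hσ hν (by simpa using hT)
    (by rwa [abs_of_pos hq])).1
  rw [← hX.law_increments 0 T hT, integrable_map_measure (by fun_prop)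
    hD.aemeasurable] at hexp
  refine (hexp.const_mul ((S₀ * Real.exp ((r + martAdj σ ν) * T)) ^ q)).congr ?_
  filter_upwards [hX.start_zero] with w hw
  simp only [Function.comp, hw, sub_zero, stock]
  rw [Real.exp_add, ← mul_assoc, Real.mul_rpow (x := S₀ * _) (by positivity) (by positivity),
    ← Real.exp_mul (X T w), mul_comm q]

theorem indicator_Ioi_neg_eq {K q y : ℝ} :
    (Set.Ioi (-y)).indicator (fun x => K * Real.exp (q * (y + x))) =
      fun x => K * (Set.Ioi (-y)).indicator (fun x => Real.exp (q * (y + x))) x := by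
  ext x
  by_cases hx : x ∈ Set.Ioi (-y) <;> simp only [hx, Set.indicator_of_mem, Set.indicator_of_notMem,
    not_false_eq_true, mul_zero]

/-- Conditional value of the call: the payoff is integrated against the law of the increment. -/
theorem powerCallValue_ae_eq {Ω : Type*} [mΩ : MeasurableSpace Ω] {Q : Measure Ω}
    [IsProbabilityMeasure Q] {ℱ : Filtration ℝ≥0 mΩ} {X : ℝ≥0 → Ω → ℝ} {S₀ K r q σ ν : ℝ}
    {t T : ℝ≥0} (hS : 0 < S₀) (hK : 0 < K) (hq : 0 < q) (htT : t < T)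
    (hX : IsVGProcess Q ℱ σ ν X)
    (hint : Integrable (fun w => powerPayoff q K (stock S₀ r σ ν X T w)) Q) :
    powerCallValue Q ℱ S₀ K r q σ ν X t T =ᵐ[Q] fun w =>
      K * Real.exp (-r * ((T : ℝ) - t)) *
        ∫ x in Set.Ioi (-powerMoneyness (stock S₀ r σ ν X t w) K r q σ ν (T - t)),
          Real.exp (q * (powerMoneyness (stock S₀ r σ ν X t w) K r q σ ν (T - t) + x))
            ∂vgLaw σ ν ((T : ℝ) - t) := by
  let g : ℝ → ℝ → ℝ := fun y x => Real.exp (-r * ((T : ℝ) - t)) *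
    (Set.Ioi (-y)).indicator (fun x => K * Real.exp (q * (y + x))) x
  have hg : Measurable (Function.uncurry g) := by
    refine Measurable.const_mul ?_ _
    have : (fun p : ℝ × ℝ => (Set.Ioi (-p.1)).indicator
        (fun x => K * Real.exp (q * (p.1 + x))) p.2) =
        {p : ℝ × ℝ | -p.1 < p.2}.indicator (fun p => K * Real.exp (q * (p.1 + p.2))) := by
      ext p; simp [Set.indicator]
    rw [this]
    exact Measurable.indicator (by fun_prop) (measurableSet_lt (by fun_prop) (by fun_prop))
  have hY : Measurable[ℱ t] fun w =>
      powerMoneyness (stock S₀ r σ ν X t w) K r q σ ν ((T : ℝ) - t) := by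
    have h : Measurable fun x : ℝ => powerMoneyness
        (S₀ * Real.exp ((r + martAdj σ ν) * t + x)) K r q σ ν ((T : ℝ) - t) := by
      unfold powerMoneyness
      fun_prop
    exact h.comp (hX.adapted t)
  have hm : ∀ u, Measurable (X u) := fun u => (hX.adapted u).mono (ℱ.le u) le_rfl
  have e : ∀ w, Real.exp (-r * ((T : ℝ) - t)) * powerPayoff q K (stock S₀ r σ ν X T w) =
      g (powerMoneyness (stock S₀ r σ ν X t w) K r q σ ν ((T : ℝ) - t)) (X T w - X t w) := fun w => by
    rw [stock_eq_mul_exp S₀ r σ ν X t T, powerPayoff_eq_exp (stock_pos hS r σ ν X t w) hK hq]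
  have key := condExp_comp_of_indep (ℱ.le t) hY ((hm T).sub (hm t)) (hX.indep_increments t T htT)
    hg ((hint.const_mul (Real.exp (-r * ((T : ℝ) - t)))).congr (ae_of_all _ e))
  unfold powerCallValue
  simp_rw [e]
  refine key.trans (ae_of_all _ fun w => ?_)
  simp only [g]
  rw [← hX.law_increments t T htT, integral_const_mul, indicator_Ioi_neg_eq, integral_const_mul,
    integral_indicator measurableSet_Ioi]
  ring_nf
  rfl

theorem condExp_stock_rpow_ae_eq {Ω : Type*} [mΩ : MeasurableSpace Ω] {Q : Measure Ω}
    [IsProbabilityMeasure Q] {ℱ : Filtration ℝ≥0 mΩ} {X : ℝ≥0 → Ω → ℝ} {S₀ r q σ ν : ℝ}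
    {t T : ℝ≥0} (hS : 0 < S₀) (hq : 0 < q) (hσ : 0 < σ) (hν : 0 < ν) (htT : t < T)
    (hX : IsVGProcess Q ℱ σ ν X) (hmom : q * rescaledVol σ ν < 1) :
    condExp (ℱ t) Q (fun w => Real.exp (-r * ((T : ℝ) - t)) * stock S₀ r σ ν X T w ^ q) =ᵐ[Q]
      fun w => discountedMoment (stock S₀ r σ ν X t w) r q σ ν ((T : ℝ) - t) := by
  have hτ : 0 < (T : ℝ) - t := sub_pos.2 (by exact_mod_cast htT)
  -- No strike is involved here; the moneyness for strike `1` merely serves as the `ℱ t`-measurable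
  -- coordinate of the freezing lemma.
  let g : ℝ → ℝ → ℝ := fun y x => Real.exp (-r * ((T : ℝ) - t)) * (1 * Real.exp (q * (y + x)))
  have hY : Measurable[ℱ t] fun w =>
      powerMoneyness (stock S₀ r σ ν X t w) 1 r q σ ν ((T : ℝ) - t) := by
    have h : Measurable fun x : ℝ => powerMoneyness
        (S₀ * Real.exp ((r + martAdj σ ν) * t + x)) 1 r q σ ν ((T : ℝ) - t) := by
      unfold powerMoneyness
      fun_prop
    exact h.comp (hX.adapted t)
  have hm : ∀ u, Measurable (X u) := fun u => (hX.adapted u).mono (ℱ.le u) le_rfl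
  have e : ∀ w, Real.exp (-r * ((T : ℝ) - t)) * stock S₀ r σ ν X T w ^ q =
      g (powerMoneyness (stock S₀ r σ ν X t w) 1 r q σ ν ((T : ℝ) - t)) (X T w - X t w) := fun w => by
    rw [stock_eq_mul_exp S₀ r σ ν X t T,
      rpow_eq_exp_powerMoneyness (stock_pos hS r σ ν X t w) one_pos hq]
  have hint := integrable_stock_rpow r hS hq hσ hν (zero_le.trans_lt htT) hX hmom
  have key := condExp_comp_of_indep (ℱ.le t) hY ((hm T).sub (hm t)) (hX.indep_increments t T htT)
    (g := g) (by unfold Function.uncurry; fun_prop)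
    ((hint.const_mul (Real.exp (-r * ((T : ℝ) - t)))).congr (ae_of_all _ e))
  simp_rw [e]
  refine key.trans (ae_of_all _ fun w => ?_)
  simp only [g]
  have hmgf := (exp_moment_vgLaw hσ hν hτ (c := q) (by rwa [abs_of_pos hq])).2
  rw [discountedMoment_eq_exp (stock_pos hS r σ ν X t w) one_pos hq, ← hmgf,
    ← hX.law_increments t T htT, integral_const_mul]
  simp_rw [mul_add, Real.exp_add, one_mul, integral_const_mul]
  rfl


/-! ### The three moneyness regimes and the conclusion. -/

theorem integrable_powerPayoff {Ω : Type*} [MeasurableSpace Ω] {Q : Measure Ω} {q K : ℝ}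
    {S : Ω → ℝ} (hS : ∀ w, 0 ≤ S w) (hSm : Measurable S) (hint : Integrable (fun w => S w ^ q) Q) :
    Integrable (fun w => powerPayoff q K (S w)) Q := by
  have hm : Measurable (powerPayoff q K) := by
    have : powerPayoff q K = {s : ℝ | K < s ^ q}.indicator (fun s => s ^ q) := rfl
    rw [this]
    exact Measurable.indicator (by fun_prop) (measurableSet_lt (by fun_prop) (by fun_prop))
  refine hint.mono' (hm.comp hSm).aestronglyMeasurable (ae_of_all _ fun w => ?_)
  have h0 := Real.rpow_nonneg (hS w) q
  simp only [powerPayoff]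
  split_ifs
  · rw [Real.norm_of_nonneg h0]
  · simpa using h0

/-- The out-of-the-money formula, in terms of the law of the increment. -/
theorem summable_and_integral_of_neg {K r q σ ν τ k : ℝ} (hσ : 0 < σ) (hν : 0 < ν) (hτ : 0 < τ)
    (hα : ∀ m : ℤ, τ / ν - 1 / 2 ≠ m) (hq : 0 < q) (hmom : q * rescaledVol σ ν < 1) (hk : k < 0) :
    Summable (powerTerm (τ / ν - 1 / 2) q k (rescaledVol σ ν)) ∧
      K * Real.exp (-r * τ) * ∫ x in Set.Ioi (-k), Real.exp (q * (k + x)) ∂vgLaw σ ν τ =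
        powerSeries K r ν τ q k (rescaledVol σ ν) := by
  have hG := Real.Gamma_pos_of_pos (show 0 < τ / ν by positivity)
  have h := hasSum_setIntegral_Ioi_vgLaw hσ hν hτ hα (neg_pos.2 hk) (p := q)
    (by rwa [abs_of_pos hq])
  simp_rw [← powerTerm_neg_left, neg_neg] at h
  refine ⟨h.summable, ?_⟩
  rw [powerSeries, h.tsum_eq]
  simp_rw [sub_neg_eq_add, add_comm _ k]
  field_simp

/-- The at-the-money formula, in terms of the law of the increment. -/
theorem summable_and_integral_zero {K r q σ ν τ : ℝ} (hσ : 0 < σ) (hν : 0 < ν) (hτ : 0 < τ)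
    (hq : 0 < q) (hmom : q * rescaledVol σ ν < 1) :
    Summable (atmTerm (τ / ν - 1 / 2) q (rescaledVol σ ν)) ∧
      K * Real.exp (-r * τ) * ∫ x in Set.Ioi 0, Real.exp (q * x) ∂vgLaw σ ν τ =
        atmSeries K r ν τ q (rescaledVol σ ν) := by
  have hG := Real.Gamma_pos_of_pos (show 0 < τ / ν by positivity)
  have h : HasSum (atmTerm (τ / ν - 1 / 2) q (rescaledVol σ ν))
      (2 * Real.Gamma (τ / ν) * ∫ x in Set.Ioi 0, Real.exp (q * x) ∂vgLaw σ ν τ) := by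
    refine ((hasSum_setIntegral_exp_vgLaw hσ hν hτ (c := q) (by rwa [abs_of_pos hq])).mul_left
      (2 * Real.Gamma (τ / ν))).congr_fun fun n => ?_
    rw [atmTerm, show ((n : ℝ) + 1) / 2 + (τ / ν - 1 / 2) = τ / ν + n / 2 by ring]
    field_simp
  refine ⟨h.summable, ?_⟩
  rw [atmSeries, h.tsum_eq]
  field_simp

/-- The in-the-money formula, in terms of the law of the increment. -/
theorem summable_and_integral_of_pos {K r q σ ν τ k : ℝ} (hσ : 0 < σ) (hν : 0 < ν) (hτ : 0 < τ)
    (hα : ∀ m : ℤ, τ / ν - 1 / 2 ≠ m) (hq : 0 < q) (hmom : q * rescaledVol σ ν < 1) (hk : 0 < k) :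
    Summable (powerTerm (τ / ν - 1 / 2) q k (-rescaledVol σ ν)) ∧
      K * Real.exp (-r * τ) * ∫ x in Set.Ioi (-k), Real.exp (q * (k + x)) ∂vgLaw σ ν τ =
        K * Real.exp (-r * τ) *
          (Real.exp (q * k) * (1 - q ^ 2 * rescaledVol σ ν ^ 2) ^ (-(τ / ν))) -
        powerSeries K r ν τ q k (-rescaledVol σ ν) := by
  have hG := Real.Gamma_pos_of_pos (show 0 < τ / ν by positivity)
  obtain ⟨hi, hv⟩ := exp_moment_vgLaw hσ hν hτ (c := q) (by rwa [abs_of_pos hq])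
  have h := hasSum_setIntegral_Ioi_vgLaw hσ hν hτ hα hk (p := -q)
    (by rwa [abs_neg, abs_of_pos hq])
  simp_rw [← powerTerm_neg_right] at h
  refine ⟨h.summable, ?_⟩
  have e : ∀ x, Real.exp (q * (k + x)) = Real.exp (q * k) * Real.exp (q * x) := fun x => by
    rw [mul_add, Real.exp_add]
  have hi' : Integrable (fun x => Real.exp (q * (k + x))) (vgLaw σ ν τ) := by
    simp_rw [e]; exact hi.const_mul _
  -- The missing lower tail is reflected onto `(k, ∞)`, where the integrand becomes `exp (-q (x -
  -- k))`: the out-of-the-money integral with exponent `-q`.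
  have htot := integral_add_compl (s := Set.Iic (-k)) measurableSet_Iic hi'
  rw [Set.compl_Iic, setIntegral_Iic_neg_vgLaw hσ hν hτ] at htot
  simp_rw [fun x => show q * (k + -x) = -q * (x - k) by ring] at htot
  have htot' : ∫ x, Real.exp (q * (k + x)) ∂vgLaw σ ν τ =
      Real.exp (q * k) * (1 - q ^ 2 * rescaledVol σ ν ^ 2) ^ (-(τ / ν)) := by
    simp_rw [e]; rw [integral_const_mul, hv]
  rw [powerSeries, h.tsum_eq, ← htot', ← htot]
  field_simp
  ring

end SymVG

open SymVG in
theorem mainTheorem8 {Ω : Type*} [mΩ : MeasurableSpace Ω] (Q : Measure Ω) [IsProbabilityMeasure Q]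
    (ℱ : Filtration ℝ≥0 mΩ) (X : ℝ≥0 → Ω → ℝ) (S₀ K r q σ ν : ℝ) (t T : ℝ≥0)
    (hS : 0 < S₀) (hK : 0 < K) (hq : 1 ≤ q) (hσ : 0 < σ) (hν : 0 < ν) (htT : t < T)
    (hX : IsVGProcess Q ℱ σ ν X)
    -- the `q`-th moment of the terminal price is finite
    (hmom : q * rescaledVol σ ν < 1)
    -- `α = τ / ν - 1/2` is not an integer
    (hα : ∀ m : ℤ, ((T : ℝ) - t) / ν - 1 / 2 ≠ m) :
    Integrable (fun w => stock S₀ r σ ν X T w ^ q) Q ∧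
    Integrable (fun w => powerPayoff q K (stock S₀ r σ ν X T w)) Q ∧
    ∀ᵐ w ∂Q,
      -- out of the money
      (powerMoneyness (stock S₀ r σ ν X t w) K r q σ ν (T - t) < 0 →
        Summable (powerTerm ((T - t) / ν - 1 / 2) q
          (powerMoneyness (stock S₀ r σ ν X t w) K r q σ ν (T - t)) (rescaledVol σ ν)) ∧
        powerCallValue Q ℱ S₀ K r q σ ν X t T w =
          powerSeries K r ν (T - t) q
            (powerMoneyness (stock S₀ r σ ν X t w) K r q σ ν (T - t)) (rescaledVol σ ν)) ∧
      -- at the money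
      (powerMoneyness (stock S₀ r σ ν X t w) K r q σ ν (T - t) = 0 →
        Summable (atmTerm ((T - t) / ν - 1 / 2) q (rescaledVol σ ν)) ∧
        powerCallValue Q ℱ S₀ K r q σ ν X t T w =
          atmSeries K r ν (T - t) q (rescaledVol σ ν)) ∧
      -- in the money
      (0 < powerMoneyness (stock S₀ r σ ν X t w) K r q σ ν (T - t) →
        Summable (powerTerm ((T - t) / ν - 1 / 2) q
          (powerMoneyness (stock S₀ r σ ν X t w) K r q σ ν (T - t)) (-rescaledVol σ ν)) ∧
        powerCallValue Q ℱ S₀ K r q σ ν X t T w =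
          discountedMoment (stock S₀ r σ ν X t w) r q σ ν (T - t) -
          powerSeries K r ν (T - t) q
            (powerMoneyness (stock S₀ r σ ν X t w) K r q σ ν (T - t)) (-rescaledVol σ ν)) ∧
      -- the first term of the parity relation is the discounted expectation of `S_T ^ q`
      condExp (ℱ t) Q
          (fun w' => Real.exp (-r * ((T : ℝ) - t)) * stock S₀ r σ ν X T w' ^ q) w =
        discountedMoment (stock S₀ r σ ν X t w) r q σ ν (T - t) := by
  have hq0 : 0 < q := by linarith
  have hτ : 0 < (T : ℝ) - t := sub_pos.2 (by exact_mod_cast htT)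
  have hm : Measurable (stock S₀ r σ ν X T) := by
    have := (hX.adapted T).mono (ℱ.le T) le_rfl
    unfold stock
    fun_prop
  have hint := integrable_stock_rpow r hS hq0 hσ hν (zero_le.trans_lt htT) hX hmom
  have hpay := integrable_powerPayoff (K := K) (fun w => (stock_pos hS r σ ν X T w).le) hm hint
  refine ⟨hint, hpay, ?_⟩
  -- Only these two conditional expectations need an exceptional null set; the series identities
  -- hold for every value of the moneyness in their regime.
  filter_upwards [powerCallValue_ae_eq hS hK hq0 htT hX hpay,
    condExp_stock_rpow_ae_eq (r := r) hS hq0 hσ hν htT hX hmom] with w hC hM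
  rw [hC]
  refine ⟨fun h => summable_and_integral_of_neg hσ hν hτ hα hq0 hmom h, fun h => ?_, fun h => ?_,
    hM⟩
  · rw [h, neg_zero]
    simp_rw [zero_add]
    exact summable_and_integral_zero hσ hν hτ hq0 hmom
  · rw [discountedMoment_eq_exp (stock_pos hS r σ ν X t w) hK hq0]
    exact summable_and_integral_of_pos hσ hν hτ hα hq0 hmom h
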